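/- Let $n \ge 2$ be an integer. The $n \times n$ grid is the planar graph whose vertices are the integer points $(x, y)$ with $1 \le x \le n$ and $1 \le y \le n$ and whose edges are the unit segments between these points; its finite faces are the $(n-1)^2$ unit square cells. The signature of a cycle $C$ in this grid is the function which assigns to each cell the number of edges of that cell which belong to $C$. The difference of two cycles is the set of all edges which belong to exactly one of them. Then the greatest possible size of the difference between two (not necessarily distinct) cycles on the $n \times n$ grid with the same signature is $n^2 - \delta_n$, where $\delta_n = n^2 \bmod 8$ is the remainder of $n^2$ on division by $8$; that is, $\delta_n = 1$ when $n$ is odd, $\delta_n = 0$ when $n \equiv 0 \pmod 4$, and $\delta_n = 4$ when $n \equiv 2 \pmod 4$. -/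

import Mathlib

namespace Slitherlink

/-- The vertices of the `m × n` grid: the integer points `(x, y)` with `1 ≤ x ≤ m`, `1 ≤ y ≤ n`. -/
noncomputable def gridVertices (m n : ℕ) : Finset (ℤ × ℤ) :=
  Finset.Icc 1 (m : ℤ) ×ˢ Finset.Icc 1 (n : ℤ)

/-- The `m × n` grid graph: its edges are the unit segments between vertices of the grid.
(As a graph on `ℤ × ℤ`; integer points which are not vertices of the grid are isolated, so they
do not occur in any cycle.) -/
def gridGraph (m n : ℕ) : SimpleGraph (ℤ × ℤ) where
  Adj p q := p ∈ gridVertices m n ∧ q ∈ gridVertices m n ∧ |p.1 - q.1| + |p.2 - q.2| = 1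
  symm := ⟨fun p q h => ⟨h.2.1, h.1, by
    rw [abs_sub_comm q.1 p.1, abs_sub_comm q.2 p.2]; exact h.2.2⟩⟩
  loopless := ⟨fun p h => by simp at h⟩

/-- `C` is (the edge set of) a cycle of the graph `G`. -/
def IsCycleEdgeSet (G : SimpleGraph (ℤ × ℤ)) (C : Finset (Sym2 (ℤ × ℤ))) : Prop :=
  ∃ (v : ℤ × ℤ) (c : G.Walk v v), c.IsCycle ∧ c.edges.toFinset = C

/-- The cells (finite faces) of the `m × n` grid, each one given by its lower left vertex. -/
noncomputable def gridCells (m n : ℕ) : Finset (ℤ × ℤ) :=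
  Finset.Ico 1 (m : ℤ) ×ˢ Finset.Ico 1 (n : ℤ)

/-- The four edges of the cell whose lower left vertex is `p`: lower, upper, left, right. -/
def cellEdges (p : ℤ × ℤ) : Finset (Sym2 (ℤ × ℤ)) :=
  {s((p.1, p.2), (p.1 + 1, p.2)), s((p.1, p.2 + 1), (p.1 + 1, p.2 + 1)),
   s((p.1, p.2), (p.1, p.2 + 1)), s((p.1 + 1, p.2), (p.1 + 1, p.2 + 1))}

/-- The signature of the edge set `C` on the `m × n` grid: it assigns to each cell of the grid the
number of edges of that cell which belong to `C`. -/
def signature (m n : ℕ) (C : Finset (Sym2 (ℤ × ℤ))) : gridCells m n → ℕ :=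
  fun p => (cellEdges p.1 ∩ C).card

end Slitherlink

namespace Slitherlink

/-! Upper bound. A cycle is the boundary of a 0/1 function on cells, zero outside the grid
(`exists_isFilling`). Let `d` be the mod 2 sum of the two functions. Equal signatures, read mod 2,
say that the four neighbours of each cell have `d`-sum zero: a discrete wave equation with zero
boundary. Hence `d` is a sum of two functions, one on each family of diagonals, and reflection at
the sides identifies them as one function `diag` of the folded index (`IsAmbiguous.cellDiff_eq`).
Its increments are letters attached to `n` billiard paths. Each edge is a crossing of two distinct
paths and lies in the difference exactly when their letters differ. Two paths account for at most
four edges, so with `p` letters of one kind and `q` of the other the difference has at most `4pq =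
n² - (p - q)²` edges (`card_symmDiff_le`).

This suffices for odd `n`. For even `n` it remains to see that `p` is even
(`IsAmbiguous.even_card_letterSet`). The full integer signature condition says that, around each
cell, the spins of the neighbours with a different `d` sum to zero. Weights on the cells of even
coordinate sum are built from fourth roots of unity so that the same relation holds for them.
Summing weight times spin over adjacent pairs in two orders leaves only boundary terms, and these
say that the letters `true` are equally frequent at odd and at even indices.

Lower bound. For `n = a + b` with `a` even, take the `2a × 2b` rectangle of edges in diagonal
coordinates. Half of these edges form `a` zigzag paths, which fixed edges outside the rectangle join
into one cycle; reflection in the antidiagonal keeps the fixed edges and exchanges the two halves.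
The signed difference cancels around every cell, so the signatures agree, and the difference has
`4ab` edges. Taking `a` and `b` as nearly equal as the parity of `a` allows gives the bound; for `n
= 2` the bound is zero. -/

/-! ### Edges of the grid in natural coordinates -/

/-- The horizontal unit segment with left end `(x, y)`. -/
def hEdge (x y : ℕ) : Sym2 (ℤ × ℤ) := s(((x : ℤ), (y : ℤ)), ((x : ℤ) + 1, (y : ℤ)))

/-- The vertical unit segment with lower end `(x, y)`. -/
def vEdge (x y : ℕ) : Sym2 (ℤ × ℤ) := s(((x : ℤ), (y : ℤ)), ((x : ℤ), (y : ℤ) + 1))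

theorem hEdge_inj {x y x' y' : ℕ} : hEdge x y = hEdge x' y' ↔ x = x' ∧ y = y' := by
  simp only [hEdge, Sym2.eq_iff, Prod.mk.injEq]; omega

theorem vEdge_inj {x y x' y' : ℕ} : vEdge x y = vEdge x' y' ↔ x = x' ∧ y = y' := by
  simp only [vEdge, Sym2.eq_iff, Prod.mk.injEq]; omega

theorem hEdge_ne_vEdge {x y x' y' : ℕ} : hEdge x y ≠ vEdge x' y' := by
  simp only [hEdge, vEdge, ne_eq, Sym2.eq_iff, Prod.mk.injEq]; omega

theorem hEdge_mem_edgeSet {n x y : ℕ} :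
    hEdge x y ∈ (gridGraph n n).edgeSet ↔ 1 ≤ x ∧ x + 1 ≤ n ∧ 1 ≤ y ∧ y ≤ n := by
  simp [hEdge, gridGraph, gridVertices]; omega

theorem vEdge_mem_edgeSet {n x y : ℕ} :
    vEdge x y ∈ (gridGraph n n).edgeSet ↔ 1 ≤ x ∧ x ≤ n ∧ 1 ≤ y ∧ y + 1 ≤ n := by
  simp [vEdge, gridGraph, gridVertices]; omega

theorem edge_cases {n : ℕ} {e : Sym2 (ℤ × ℤ)} (he : e ∈ (gridGraph n n).edgeSet) :
    (∃ x y : ℕ, e = hEdge x y) ∨ ∃ x y : ℕ, e = vEdge x y := by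
  induction e using Sym2.ind with
  | _ p q =>
    obtain ⟨x, y⟩ := p
    obtain ⟨x', y'⟩ := q
    simp only [gridGraph, gridVertices, SimpleGraph.mem_edgeSet, Finset.mem_product,
      Finset.mem_Icc] at he
    obtain ⟨⟨⟨h1, -⟩, h2, -⟩, ⟨⟨h3, -⟩, h4, -⟩, h5⟩ := he
    lift x to ℕ using by omega
    lift y to ℕ using by omega
    lift x' to ℕ using by omega
    lift y' to ℕ using by omega
    have : (x' = x + 1 ∧ y' = y) ∨ (x = x' + 1 ∧ y' = y) ∨ (x' = x ∧ y' = y + 1) ∨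
        (x' = x ∧ y = y' + 1) := by
      rcases abs_cases ((x : ℤ) - x') with h | h <;> rcases abs_cases ((y : ℤ) - y') with h' | h' <;>
        omega
    rcases this with ⟨rfl, rfl⟩ | ⟨rfl, rfl⟩ | ⟨rfl, rfl⟩ | ⟨rfl, rfl⟩
    · exact Or.inl ⟨x, y', by simp [hEdge]⟩
    · exact Or.inl ⟨x', y', by simp [hEdge, Sym2.eq_swap]⟩
    · exact Or.inr ⟨x', y, by simp [vEdge]⟩
    · exact Or.inr ⟨x', y', by simp [vEdge, Sym2.eq_swap]⟩

theorem card_inter_four {α : Type*} [DecidableEq α] {a b c d : α} (C : Finset α)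
    (hab : a ≠ b) (hac : a ≠ c) (had : a ≠ d) (hbc : b ≠ c) (hbd : b ≠ d) (hcd : c ≠ d) :
    (({a, b, c, d} : Finset α) ∩ C).card =
      (decide (a ∈ C)).toNat + (decide (b ∈ C)).toNat + (decide (c ∈ C)).toNat +
        (decide (d ∈ C)).toNat := by
  rw [← Finset.filter_mem_eq_inter, Finset.card_filter, Finset.sum_insert (by simp [*]),
    Finset.sum_insert (by simp [*]), Finset.sum_insert (by simp [*]), Finset.sum_singleton]
  simp only [Bool.toNat, Bool.cond_decide, add_assoc]

/-! ### The interior of a cycle as a function on cells -/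

/-- Cells `(x, y)` with `s x y = true` are the ones enclosed by the edge set `C`: the cell function
vanishes outside of the grid, and an edge belongs to `C` iff its two sides differ. -/
structure IsFilling (n : ℕ) (C : Finset (Sym2 (ℤ × ℤ))) (s : ℕ → ℕ → Bool) : Prop where
  bot : ∀ x, s x 0 = false
  top : ∀ x, s x n = false
  left : ∀ y, s 0 y = false
  right : ∀ y, s n y = false
  hor : ∀ x y, decide (hEdge x (y + 1) ∈ C) = (s x (y + 1) ^^ s x y)
  ver : ∀ x y, decide (vEdge (x + 1) y ∈ C) = (s (x + 1) y ^^ s x y)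

/-- A closed trail enters and leaves each vertex equally often; the vertex here is `(x + 1, y + 1)`.
-/
theorem even_degree {n : ℕ} {C : Finset (Sym2 (ℤ × ℤ))} (hC : IsCycleEdgeSet (gridGraph n n) C)
    (x y : ℕ) :
    Even ((decide (hEdge x (y + 1) ∈ C)).toNat + (decide (hEdge (x + 1) (y + 1) ∈ C)).toNat +
      (decide (vEdge (x + 1) y ∈ C)).toNat + (decide (vEdge (x + 1) (y + 1) ∈ C)).toNat) := by
  obtain ⟨v, c, hc, rfl⟩ := hC
  have h1 := (hc.isTrail.even_countP_edges_iff ((x : ℤ) + 1, (y : ℤ) + 1)).2 (by simp)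
  rw [← card_inter_four _ (by simp [hEdge_inj]) hEdge_ne_vEdge hEdge_ne_vEdge hEdge_ne_vEdge
    hEdge_ne_vEdge (by simp [vEdge_inj])]
  convert h1 using 1
  rw [List.countP_eq_length_filter, ← List.toFinset_card_of_nodup (hc.isTrail.edges_nodup.filter _),
    List.toFinset_filter]
  congr 1
  ext e
  simp only [Finset.mem_inter, Finset.mem_filter, List.mem_toFinset, decide_eq_true_eq]
  rw [and_comm]
  refine and_congr_right fun he => ?_
  have he' := c.edges_subset_edgeSet he
  rcases edge_cases he' with ⟨a, b, rfl⟩ | ⟨a, b, rfl⟩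
  · simp only [Finset.mem_insert, Finset.mem_singleton, hEdge_inj, hEdge_ne_vEdge, or_false]
    simp only [hEdge, Sym2.mem_iff, Prod.mk.injEq]; omega
  · simp only [Finset.mem_insert, Finset.mem_singleton, vEdge_inj, hEdge_ne_vEdge.symm, false_or]
    simp only [vEdge, Sym2.mem_iff, Prod.mk.injEq]; omega

theorem subset_edgeSet {n : ℕ} {C : Finset (Sym2 (ℤ × ℤ))}
    (hC : IsCycleEdgeSet (gridGraph n n) C) {e : Sym2 (ℤ × ℤ)} (he : e ∈ C) :
    e ∈ (gridGraph n n).edgeSet := by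
  obtain ⟨v, c, hc, rfl⟩ := hC
  exact c.edges_subset_edgeSet (by simpa using he)

theorem exists_isFilling {n : ℕ} {C : Finset (Sym2 (ℤ × ℤ))}
    (hC : IsCycleEdgeSet (gridGraph n n) C) : ∃ s, IsFilling n C s := by
  have hh : ∀ x y, hEdge x y ∈ C → 1 ≤ x ∧ x + 1 ≤ n ∧ 1 ≤ y ∧ y ≤ n :=
    fun x y h => hEdge_mem_edgeSet.1 (subset_edgeSet hC h)
  have hv : ∀ x y, vEdge x y ∈ C → 1 ≤ x ∧ x ≤ n ∧ 1 ≤ y ∧ y + 1 ≤ n :=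
    fun x y h => vEdge_mem_edgeSet.1 (subset_edgeSet hC h)
  -- Crossing parity: `s x y` counts mod 2 the horizontal edges of `C` in column `x` at heights `1`
  -- to `y`. The rule for vertical edges then follows by climbing the column, with even degree at
  -- each vertex.
  let s : ℕ → ℕ → Bool := fun x y =>
    Nat.rec false (fun k b => decide (hEdge x (k + 1) ∈ C) ^^ b) y
  have s0 : ∀ x, s x 0 = false := fun x => rfl
  have s1 : ∀ x y, s x (y + 1) = (decide (hEdge x (y + 1) ∈ C) ^^ s x y) := fun x y => rfl
  have hl : ∀ y, s 0 y = false := by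
    intro y
    induction y with
    | zero => rfl
    | succ y ih =>
      rw [s1, ih, decide_eq_false (fun h => by have := hh _ _ h; omega)]; rfl
  have hr : ∀ y, s n y = false := by
    intro y
    induction y with
    | zero => rfl
    | succ y ih =>
      rw [s1, ih, decide_eq_false (fun h => by have := hh _ _ h; omega)]; rfl
  have hver : ∀ x y, decide (vEdge (x + 1) y ∈ C) = (s (x + 1) y ^^ s x y) := by
    intro x y
    induction y with
    | zero => rw [decide_eq_false (fun h => by have := hv _ _ h; omega)]; rfl
    | succ y ih =>
      have := even_degree hC x y
      rw [s1, s1]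
      rw [ih] at this
      revert this
      generalize decide (vEdge (x + 1) (y + 1) ∈ C) = a
      generalize decide (hEdge (x + 1) (y + 1) ∈ C) = b
      generalize decide (hEdge x (y + 1) ∈ C) = c
      generalize s (x + 1) y = d
      generalize s x y = e
      revert a b c d e
      decide
  refine ⟨s, s0, fun x => ?_, hl, hr, fun x y => ?_, hver⟩
  · induction x with
    | zero => exact hl n
    | succ x ih =>
      have := hver x n
      rw [decide_eq_false (fun h => by have := hv _ _ h; omega), ih] at this
      simpa using this.symm
  · rw [s1, Bool.xor_assoc, Bool.xor_self, Bool.xor_false]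

theorem signature_apply {n : ℕ} {C : Finset (Sym2 (ℤ × ℤ))} {x y : ℕ}
    (h : ((x : ℤ), (y : ℤ)) ∈ gridCells n n) :
    signature n n C ⟨_, h⟩ =
      (decide (hEdge x y ∈ C)).toNat + (decide (hEdge x (y + 1) ∈ C)).toNat +
      (decide (vEdge x y ∈ C)).toNat + (decide (vEdge (x + 1) y ∈ C)).toNat := by
  rw [← card_inter_four _ (by simp [hEdge_inj]) hEdge_ne_vEdge hEdge_ne_vEdge hEdge_ne_vEdge
    hEdge_ne_vEdge (by simp [vEdge_inj])]
  simp [signature, cellEdges, hEdge, vEdge]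

/-! ### Pairs of cell functions with equal signatures -/

/-- A pair of cell functions on the `n × n` grid, both zero outside of the grid, such that around
each cell they have equally many sign changes. -/
structure IsAmbiguous (n : ℕ) (s₁ s₂ : ℕ → ℕ → Bool) : Prop where
  bot : ∀ x, s₁ x 0 = false ∧ s₂ x 0 = false
  top : ∀ x, s₁ x n = false ∧ s₂ x n = false
  left : ∀ y, s₁ 0 y = false ∧ s₂ 0 y = false
  right : ∀ y, s₁ n y = false ∧ s₂ n y = false
  sig : ∀ x y, x + 2 ≤ n → y + 2 ≤ n →
    (s₁ (x + 1) (y + 1) ^^ s₁ (x + 1) y).toNat + (s₁ (x + 1) (y + 2) ^^ s₁ (x + 1) (y + 1)).toNat +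
      (s₁ (x + 1) (y + 1) ^^ s₁ x (y + 1)).toNat + (s₁ (x + 2) (y + 1) ^^ s₁ (x + 1) (y + 1)).toNat =
    (s₂ (x + 1) (y + 1) ^^ s₂ (x + 1) y).toNat + (s₂ (x + 1) (y + 2) ^^ s₂ (x + 1) (y + 1)).toNat +
      (s₂ (x + 1) (y + 1) ^^ s₂ x (y + 1)).toNat + (s₂ (x + 2) (y + 1) ^^ s₂ (x + 1) (y + 1)).toNat

theorem IsFilling.isAmbiguous {n : ℕ} {C₁ C₂ : Finset (Sym2 (ℤ × ℤ))} {s₁ s₂ : ℕ → ℕ → Bool}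
    (h₁ : IsFilling n C₁ s₁) (h₂ : IsFilling n C₂ s₂)
    (h : signature n n C₁ = signature n n C₂) : IsAmbiguous n s₁ s₂ where
  bot x := ⟨h₁.bot x, h₂.bot x⟩
  top x := ⟨h₁.top x, h₂.top x⟩
  left x := ⟨h₁.left x, h₂.left x⟩
  right x := ⟨h₁.right x, h₂.right x⟩
  sig x y hx hy := by
    have hp : (((x + 1 : ℕ) : ℤ), ((y + 1 : ℕ) : ℤ)) ∈ gridCells n n := by
      simp [gridCells]; omega
    have := congrFun h ⟨_, hp⟩
    rw [signature_apply, signature_apply, h₁.hor, h₁.hor, h₁.ver, h₁.ver, h₂.hor, h₂.hor, h₂.ver,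
      h₂.ver] at this
    exact this

/-- The spin `±1` of a cell. -/
def spin (b : Bool) : ℤ := bif b then -1 else 1

/-- Mod 2 the centre cell is counted four times and drops out, which leaves a linear relation
between the neighbours. -/
theorem even_of_balanced : ∀ p e w n s p' e' w' n' s' : Bool,
    (p ^^ s).toNat + (n ^^ p).toNat + (p ^^ w).toNat + (e ^^ p).toNat =
      (p' ^^ s').toNat + (n' ^^ p').toNat + (p' ^^ w').toNat + (e' ^^ p').toNat →
    (n ^^ n') = ((w ^^ w') ^^ (e ^^ e') ^^ (s ^^ s')) := by
  decide

/-- Equal numbers of sign changes mean that centre spin times the sum of neighbour spins is the same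
for both functions. Passing to the second function flips the product for a neighbour exactly when
its difference bit differs from that of the centre, so the flipped products sum to zero. -/
theorem spin_sum_of_balanced : ∀ p e w n s p' e' w' n' s' : Bool,
    (p ^^ s).toNat + (n ^^ p).toNat + (p ^^ w).toNat + (e ^^ p).toNat =
      (p' ^^ s').toNat + (n' ^^ p').toNat + (p' ^^ w').toNat + (e' ^^ p').toNat →
    (((e ^^ e') ^^ (p ^^ p')).toNat : ℤ) * spin e + ((w ^^ w') ^^ (p ^^ p')).toNat * spin w +
      ((n ^^ n') ^^ (p ^^ p')).toNat * spin n + ((s ^^ s') ^^ (p ^^ p')).toNat * spin s = 0 := by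
  decide

/-! ### The difference as a sum over diagonals -/

/-- The cells enclosed by exactly one of the two edge sets. -/
def cellDiff (s₁ s₂ : ℕ → ℕ → Bool) (x y : ℕ) : Bool := s₁ x y ^^ s₂ x y

/-- The coefficients of the diagonals in the description of `cellDiff` as a sum over the two
diagonals through a cell. -/
def diag (s₁ s₂ : ℕ → ℕ → Bool) : ℕ → Bool
  | 0 => false
  | 1 => false
  | k + 2 => cellDiff s₁ s₂ (k + 1) 1 ^^ diag s₁ s₂ k

/-- Reflection of diagonal indices in the corner `n`. -/
def fold (n k : ℕ) : ℕ := min k (2 * n - k)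

variable {n : ℕ} {s₁ s₂ : ℕ → ℕ → Bool}

theorem IsAmbiguous.cellDiff_step (h : IsAmbiguous n s₁ s₂) {x y : ℕ} (hx : x + 2 ≤ n)
    (hy : y + 2 ≤ n) :
    cellDiff s₁ s₂ (x + 1) (y + 2) = (cellDiff s₁ s₂ x (y + 1) ^^ cellDiff s₁ s₂ (x + 2) (y + 1) ^^
      cellDiff s₁ s₂ (x + 1) y) :=
  even_of_balanced _ _ _ _ _ _ _ _ _ _ (h.sig x y hx hy)

theorem IsAmbiguous.spin_sum (h : IsAmbiguous n s₁ s₂) {x y : ℕ} (hx : x + 2 ≤ n)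
    (hy : y + 2 ≤ n) :
    ((cellDiff s₁ s₂ (x + 2) (y + 1) ^^ cellDiff s₁ s₂ (x + 1) (y + 1)).toNat : ℤ) *
        spin (s₁ (x + 2) (y + 1)) +
      (cellDiff s₁ s₂ x (y + 1) ^^ cellDiff s₁ s₂ (x + 1) (y + 1)).toNat * spin (s₁ x (y + 1)) +
      (cellDiff s₁ s₂ (x + 1) (y + 2) ^^ cellDiff s₁ s₂ (x + 1) (y + 1)).toNat *
        spin (s₁ (x + 1) (y + 2)) +
      (cellDiff s₁ s₂ (x + 1) y ^^ cellDiff s₁ s₂ (x + 1) (y + 1)).toNat *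
        spin (s₁ (x + 1) y) = 0 :=
  spin_sum_of_balanced _ _ _ _ _ _ _ _ _ _ (h.sig x y hx hy)

theorem IsAmbiguous.cellDiff_eq_zero (h : IsAmbiguous n s₁ s₂) {x y : ℕ}
    (hxy : x = 0 ∨ x = n ∨ y = 0 ∨ y = n) : cellDiff s₁ s₂ x y = false := by
  rcases hxy with rfl | rfl | rfl | rfl <;> simp [cellDiff, h.bot, h.top, h.left, h.right]

/-- Both sides satisfy the recurrence of `cellDiff_step` in `y`, so agreement on rows `0` and `1`
and on the two side columns suffices. Row `1` is the recursion defining `diag`; on the boundary both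
sides vanish because there `fold n (x + y)` equals `|x - y|`. -/
theorem IsAmbiguous.cellDiff_eq (h : IsAmbiguous n s₁ s₂) : ∀ y ≤ n, ∀ x ≤ n,
    cellDiff s₁ s₂ x y = (diag s₁ s₂ (fold n (x + y)) ^^ diag s₁ s₂ (x - y + (y - x))) := by
  have h0 : ∀ x ≤ n, ∀ y ≤ n, x = 0 ∨ x = n →
      cellDiff s₁ s₂ x y = (diag s₁ s₂ (fold n (x + y)) ^^ diag s₁ s₂ (x - y + (y - x))) := by
    rintro x hx y hy hxy
    rw [h.cellDiff_eq_zero (by omega), show fold n (x + y) = x - y + (y - x) by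
      unfold fold; omega, Bool.xor_self]
  suffices H : ∀ y, (y ≤ n → ∀ x ≤ n, cellDiff s₁ s₂ x y =
      (diag s₁ s₂ (fold n (x + y)) ^^ diag s₁ s₂ (x - y + (y - x)))) ∧
      (y + 1 ≤ n → ∀ x ≤ n, cellDiff s₁ s₂ x (y + 1) =
      (diag s₁ s₂ (fold n (x + (y + 1))) ^^ diag s₁ s₂ (x - (y + 1) + (y + 1 - x)))) from
    fun y => (H y).1
  intro y
  induction y with
  | zero =>
    refine ⟨fun _ x hx => ?_, fun hn x hx => ?_⟩
    · rw [h.cellDiff_eq_zero (by simp), show fold n (x + 0) = x - 0 + (0 - x) by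
        unfold fold; omega, Bool.xor_self]
    · by_cases hx0 : x = 0 ∨ x = n
      · exact h0 x hx _ hn hx0
      · obtain ⟨k, rfl⟩ : ∃ k, x = k + 1 := ⟨x - 1, by omega⟩
        rw [show fold n (k + 1 + (0 + 1)) = k + 2 by unfold fold; omega,
          show k + 1 - (0 + 1) + (0 + 1 - (k + 1)) = k by omega, diag, Bool.xor_assoc,
          Bool.xor_self, Bool.xor_false]
  | succ y ih =>
    refine ⟨ih.2, fun hn x hx => ?_⟩
    by_cases hx0 : x = 0 ∨ x = n
    · exact h0 x hx _ hn hx0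
    obtain ⟨k, rfl⟩ : ∃ k, x = k + 1 := ⟨x - 1, by omega⟩
    rw [h.cellDiff_step (by omega) (by omega), ih.2 (by omega) k (by omega),
      ih.2 (by omega) (k + 2) (by omega), ih.1 (by omega) (k + 1) (by omega),
      show k + 1 + y = k + (y + 1) by omega, show k + 1 + (y + 1 + 1) = k + 2 + (y + 1) by omega,
      show k + 1 - y + (y - (k + 1)) = k + 2 - (y + 1) + (y + 1 - (k + 2)) by omega,
      show k + 1 - (y + 1 + 1) + (y + 1 + 1 - (k + 1)) = k - (y + 1) + (y + 1 - k) by omega]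
    generalize diag s₁ s₂ _ = a
    generalize diag s₁ s₂ _ = b
    generalize diag s₁ s₂ _ = c
    generalize diag s₁ s₂ _ = d
    revert a b c d
    decide

/-! ### Billiard paths and the product bound -/

/-- The letter of the `k`-th rectangular billiard path. -/
def letter (s₁ s₂ : ℕ → ℕ → Bool) (k : ℕ) : Bool := diag s₁ s₂ k ^^ diag s₁ s₂ (k - 1)

/-- The crossing points of the `i`-th and the `j`-th billiard path, for `j < i`, on horizontal
edges, given by the left end of the edge. -/
def crossing (n i j : ℕ) (b : Bool) : ℕ × ℕ :=
  bif b then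
    (((if (i + j) % 2 = 1 then i else 2 * n + 1 - i) + (j - 1)) / 2,
      ((if (i + j) % 2 = 1 then i else 2 * n + 1 - i) - (j - 1)) / 2)
  else
    (((if (i + j) % 2 = 0 then i else 2 * n + 1 - i) - j) / 2,
      ((if (i + j) % 2 = 0 then i else 2 * n + 1 - i) + j) / 2)

/-- Across a horizontal edge both the folded sum and the distance from the main diagonal change by
one, so the two `diag` increments are letters `i` and `j`. The cases are the side of the fold and
the side of the main diagonal; `b` records the latter, and the parity of `i + j` then determines the
former. -/
theorem exists_crossing (s₁ s₂ : ℕ → ℕ → Bool) {x y : ℕ} (hx : 1 ≤ x) (hxn : x + 1 ≤ n)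
    (hy : y + 1 ≤ n) :
    ∃ i j b, 1 ≤ j ∧ j < i ∧ i ≤ n ∧ crossing n i j b = (x, y + 1) ∧
      ((diag s₁ s₂ (fold n (x + (y + 1))) ^^ diag s₁ s₂ (x - (y + 1) + (y + 1 - x))) ^^
        (diag s₁ s₂ (fold n (x + y)) ^^ diag s₁ s₂ (x - y + (y - x)))) =
      (letter s₁ s₂ i ^^ letter s₁ s₂ j) := by
  have key : ∀ a b c d : Bool, ((a ^^ c) ^^ (b ^^ d)) = ((a ^^ b) ^^ (c ^^ d)) ∧
      ((b ^^ c) ^^ (a ^^ d)) = ((a ^^ b) ^^ (c ^^ d)) ∧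
      ((a ^^ d) ^^ (b ^^ c)) = ((a ^^ b) ^^ (c ^^ d)) ∧
      ((b ^^ d) ^^ (a ^^ c)) = ((a ^^ b) ^^ (c ^^ d)) := by decide
  rcases le_or_gt (x + (y + 1)) n with hu | hu <;> rcases le_or_gt (y + 1) x with hd | hd
  · refine ⟨x + (y + 1), x - y, true, by omega, by omega, by omega, ?_, ?_⟩
    · rw [crossing, cond_true, if_pos (by omega)]; ext <;> simp only <;> omega
    · rw [letter, letter, show fold n (x + (y + 1)) = x + (y + 1) by unfold fold; omega,
        show fold n (x + y) = x + (y + 1) - 1 by unfold fold; omega,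
        show x - (y + 1) + (y + 1 - x) = x - y - 1 by omega, show x - y + (y - x) = x - y by omega]
      exact (key _ _ _ _).2.2.1
  · refine ⟨x + (y + 1), y + 1 - x, false, by omega, by omega, by omega, ?_, ?_⟩
    · rw [crossing, cond_false, if_pos (by omega)]; ext <;> simp only <;> omega
    · rw [letter, letter, show fold n (x + (y + 1)) = x + (y + 1) by unfold fold; omega,
        show fold n (x + y) = x + (y + 1) - 1 by unfold fold; omega,
        show x - (y + 1) + (y + 1 - x) = y + 1 - x by omega,
        show x - y + (y - x) = y + 1 - x - 1 by omega]
      exact (key _ _ _ _).1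
  · refine ⟨2 * n + 1 - (x + (y + 1)), x - y, true, by omega, by omega, by omega, ?_, ?_⟩
    · rw [crossing, cond_true, if_neg (by omega)]; ext <;> simp only <;> omega
    · rw [letter, letter,
        show fold n (x + (y + 1)) = 2 * n + 1 - (x + (y + 1)) - 1 by unfold fold; omega,
        show fold n (x + y) = 2 * n + 1 - (x + (y + 1)) by unfold fold; omega,
        show x - (y + 1) + (y + 1 - x) = x - y - 1 by omega, show x - y + (y - x) = x - y by omega]
      exact (key _ _ _ _).2.2.2
  · refine ⟨2 * n + 1 - (x + (y + 1)), y + 1 - x, false, by omega, by omega, by omega, ?_, ?_⟩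
    · rw [crossing, cond_false, if_neg (by omega)]; ext <;> simp only <;> omega
    · rw [letter, letter,
        show fold n (x + (y + 1)) = 2 * n + 1 - (x + (y + 1)) - 1 by unfold fold; omega,
        show fold n (x + y) = 2 * n + 1 - (x + (y + 1)) by unfold fold; omega,
        show x - (y + 1) + (y + 1 - x) = y + 1 - x by omega,
        show x - y + (y - x) = y + 1 - x - 1 by omega]
      exact (key _ _ _ _).2.1

/-- The indices of the billiard paths with letter `b`. -/
def letterSet (n : ℕ) (s₁ s₂ : ℕ → ℕ → Bool) (b : Bool) : Finset ℕ :=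
  (Finset.Icc 1 n).filter fun k => letter s₁ s₂ k = b

theorem card_letterSet_add (n : ℕ) (s₁ s₂ : ℕ → ℕ → Bool) :
    (letterSet n s₁ s₂ true).card + (letterSet n s₁ s₂ false).card = n := by
  have := Finset.card_filter_add_card_filter_not (s := Finset.Icc 1 n)
    (fun k => letter s₁ s₂ k = true)
  simpa [letterSet] using this

theorem card_symmDiff_le {C₁ C₂ : Finset (Sym2 (ℤ × ℤ))}
    (hC₁ : IsCycleEdgeSet (gridGraph n n) C₁) (hC₂ : IsCycleEdgeSet (gridGraph n n) C₂)
    (h₁ : IsFilling n C₁ s₁) (h₂ : IsFilling n C₂ s₂) (h : IsAmbiguous n s₁ s₂) :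
    (symmDiff C₁ C₂).card ≤
      4 * ((letterSet n s₁ s₂ true).card * (letterSet n s₁ s₂ false).card) := by
  -- A pair of indices with letters `true` and `false`, in this order, and two bits: the side of the
  -- main diagonal, and horizontal or vertical. Since `crossing` expects the larger index first, the
  -- pair is sorted.
  let g : (ℕ × ℕ) × (Bool × Bool) → Sym2 (ℤ × ℤ) := fun p =>
    let c := crossing n (max p.1.1 p.1.2) (min p.1.1 p.1.2) p.2.1
    bif p.2.2 then hEdge c.1 c.2 else vEdge c.2 c.1
  have hg : ∀ i j b t, 1 ≤ j → j < i → i ≤ n → (letter s₁ s₂ i ^^ letter s₁ s₂ j) = true →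
      (bif t then hEdge (crossing n i j b).1 (crossing n i j b).2
        else vEdge (crossing n i j b).2 (crossing n i j b).1) ∈
      ((letterSet n s₁ s₂ true ×ˢ letterSet n s₁ s₂ false) ×ˢ
        (Finset.univ : Finset (Bool × Bool))).image g := by
    intro i j b t hj hij hi hl
    rw [Finset.mem_image]
    cases hli : letter s₁ s₂ i with
    | true =>
      refine ⟨((i, j), (b, t)), ?_, ?_⟩
      · simp_all [letterSet]; omega
      · simp only [g, max_eq_left hij.le, min_eq_right hij.le]
    | false =>
      refine ⟨((j, i), (b, t)), ?_, ?_⟩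
      · simp_all [letterSet]; omega
      · simp only [g, max_eq_right hij.le, min_eq_left hij.le]
  have hsub : symmDiff C₁ C₂ ⊆ ((letterSet n s₁ s₂ true ×ˢ letterSet n s₁ s₂ false) ×ˢ
        (Finset.univ : Finset (Bool × Bool))).image g := by
    intro e he
    have hxor : (decide (e ∈ C₁) ^^ decide (e ∈ C₂)) = true := by
      rw [Finset.mem_symmDiff] at he
      rcases he with ⟨a, b⟩ | ⟨a, b⟩ <;> simp [a, b]
    have hG : e ∈ (gridGraph n n).edgeSet := by
      rw [Finset.mem_symmDiff] at he
      rcases he with ⟨a, -⟩ | ⟨a, -⟩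
      · exact subset_edgeSet hC₁ a
      · exact subset_edgeSet hC₂ a
    have comm : ∀ a b c d : Bool, ((a ^^ b) ^^ (c ^^ d)) = ((a ^^ c) ^^ (b ^^ d)) := by decide
    rcases edge_cases hG with ⟨x, y, rfl⟩ | ⟨x, y, rfl⟩
    · rw [hEdge_mem_edgeSet] at hG
      obtain ⟨y, rfl⟩ : ∃ k, y = k + 1 := ⟨y - 1, by omega⟩
      rw [h₁.hor, h₂.hor, comm] at hxor
      change (cellDiff s₁ s₂ x (y + 1) ^^ cellDiff s₁ s₂ x y) = true at hxor
      rw [h.cellDiff_eq _ (by omega) _ (by omega), h.cellDiff_eq _ (by omega) _ (by omega)] at hxor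
      obtain ⟨i, j, b, hj, hij, hi, hc, hl⟩ := exists_crossing (n := n) s₁ s₂ (x := x) (y := y)
        (by omega) (by omega) (by omega)
      rw [hl] at hxor
      simpa [hc] using hg i j b true hj hij hi hxor
    · rw [vEdge_mem_edgeSet] at hG
      obtain ⟨x, rfl⟩ : ∃ k, x = k + 1 := ⟨x - 1, by omega⟩
      rw [h₁.ver, h₂.ver, comm] at hxor
      change (cellDiff s₁ s₂ (x + 1) y ^^ cellDiff s₁ s₂ x y) = true at hxor
      -- The diagonal formula is symmetric in `x` and `y`, so vertical edges are handled as
      -- transposed horizontal ones.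
      rw [h.cellDiff_eq _ (by omega) _ (by omega), h.cellDiff_eq _ (by omega) _ (by omega),
        add_comm (x + 1) y, add_comm (x + 1 - y), add_comm x y, add_comm (x - y)] at hxor
      obtain ⟨i, j, b, hj, hij, hi, hc, hl⟩ := exists_crossing (n := n) s₁ s₂ (x := y) (y := x)
        (by omega) (by omega) (by omega)
      rw [hl] at hxor
      simpa [hc] using hg i j b false hj hij hi hxor
  refine (Finset.card_le_card hsub).trans (Finset.card_image_le.trans ?_)
  simp [mul_comm]

/-! ### Parity of the number of letters `true` for even `n` -/

/-- A phase attached to every second diagonal, which turns by `2` between equal letters and by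
`1` or `3` between different ones. -/
def phase (s₁ s₂ : ℕ → ℕ → Bool) : ℕ → ZMod 4
  | 0 => 0
  | m + 1 => phase s₁ s₂ m + 2 + (letter s₁ s₂ (2 * m + 1)).toNat -
      (letter s₁ s₂ (2 * m + 2)).toNat

/-- The imaginary part of `i ^ t`. -/
def imPow (t : ZMod 4) : ℤ := if t = 1 then 1 else if t = 3 then -1 else 0

/-- The weight of a cell. -/
def weight (n : ℕ) (s₁ s₂ : ℕ → ℕ → Bool) (x y : ℕ) : ℤ :=
  if (x + y) % 2 = 0 then
    imPow (phase s₁ s₂ (fold n (x + y) / 2) - phase s₁ s₂ ((x - y + (y - x)) / 2))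
  else 0

/-- For one family let `e_α` be the powers of `i` on the two even diagonals next to an odd one,
`l_α` the letters in between, and `z_α = e_α i^(l_α)`. The phase rule says that the two `z_α` are
opposite. For different letters `i^(l' - l) = i (l' - l)`, so the complex sum is `i ∑ (z_α /
z'_β)(l'_β - l_α)`, which vanishes because `∑ z_α = 0` and `∑ 1 / z'_β = 0`. The identity is its
imaginary part. -/
theorem imPow_sum : ∀ (t : ZMod 4) (a b c a' b' c' : Bool) (t' : ZMod 4),
    (((c ^^ c') ^^ (b ^^ b')).toNat : ℤ) *
        imPow ((t + 2 + (b ^^ a).toNat - (c ^^ b).toNat) -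
          (t' + 2 + (b' ^^ a').toNat - (c' ^^ b').toNat)) +
      ((a ^^ a') ^^ (b ^^ b')).toNat * imPow (t - t') +
      ((c ^^ a') ^^ (b ^^ b')).toNat * imPow ((t + 2 + (b ^^ a).toNat - (c ^^ b).toNat) - t') +
      ((a ^^ c') ^^ (b ^^ b')).toNat *
        imPow (t - (t' + 2 + (b' ^^ a').toNat - (c' ^^ b').toNat)) = 0 := by
  decide

theorem phase_succ (m : ℕ) : phase s₁ s₂ (m + 1) = phase s₁ s₂ m + 2 +
    (diag s₁ s₂ (2 * m + 1) ^^ diag s₁ s₂ (2 * m)).toNat -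
    (diag s₁ s₂ (2 * m + 2) ^^ diag s₁ s₂ (2 * m + 1)).toNat := rfl

theorem weight_sum_aux (j k : ℕ) :
    (((diag s₁ s₂ (2 * j + 2) ^^ diag s₁ s₂ (2 * k + 2)) ^^
        (diag s₁ s₂ (2 * j + 1) ^^ diag s₁ s₂ (2 * k + 1))).toNat : ℤ) *
        imPow (phase s₁ s₂ (j + 1) - phase s₁ s₂ (k + 1)) +
      ((diag s₁ s₂ (2 * j) ^^ diag s₁ s₂ (2 * k)) ^^
        (diag s₁ s₂ (2 * j + 1) ^^ diag s₁ s₂ (2 * k + 1))).toNat *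
        imPow (phase s₁ s₂ j - phase s₁ s₂ k) +
      ((diag s₁ s₂ (2 * j + 2) ^^ diag s₁ s₂ (2 * k)) ^^
        (diag s₁ s₂ (2 * j + 1) ^^ diag s₁ s₂ (2 * k + 1))).toNat *
        imPow (phase s₁ s₂ (j + 1) - phase s₁ s₂ k) +
      ((diag s₁ s₂ (2 * j) ^^ diag s₁ s₂ (2 * k + 2)) ^^
        (diag s₁ s₂ (2 * j + 1) ^^ diag s₁ s₂ (2 * k + 1))).toNat *
        imPow (phase s₁ s₂ j - phase s₁ s₂ (k + 1)) = 0 := by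
  rw [phase_succ, phase_succ]
  exact imPow_sum _ _ _ _ _ _ _ _

theorem weight_of_odd {x y : ℕ} (h : (x + y) % 2 = 1) : weight n s₁ s₂ x y = 0 :=
  if_neg (by omega)

theorem weight_eq {x y J K : ℕ} (hJ : fold n (x + y) = 2 * J) (hK : x - y + (y - x) = 2 * K) :
    weight n s₁ s₂ x y = imPow (phase s₁ s₂ J - phase s₁ s₂ K) := by
  rw [weight, if_pos (by omega), hJ, hK, Nat.mul_div_cancel_left _ (by norm_num),
    Nat.mul_div_cancel_left _ (by norm_num)]

/-- On the boundary the two diagonals have the same folded index, and the imaginary part of `1` is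
zero. This is why the weight takes imaginary parts. -/
theorem weight_boundary {x y : ℕ} (hn : n % 2 = 0) (hx : x ≤ n) (hy : y ≤ n)
    (h : x = 0 ∨ x = n ∨ y = 0 ∨ y = n) : weight n s₁ s₂ x y = 0 := by
  by_cases hxy : (x + y) % 2 = 0
  · rw [weight_eq (J := (x - y + (y - x)) / 2) (K := (x - y + (y - x)) / 2)
      (by unfold fold; omega) (by omega), sub_self]
    rfl
  · exact if_neg hxy

/-- As `n` is even, a cell with odd coordinate sum is not on the fold, so its neighbours have the
two adjacent even indices. -/
theorem fold_neighbours {x y j : ℕ} (hn : n % 2 = 0) (hx : x + 2 ≤ n) (hy : y + 2 ≤ n)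
    (hj : fold n (x + 1 + (y + 1)) = 2 * j + 1) :
    fold n (x + 2 + (y + 1)) = 2 * (j + 1) ∧ fold n (x + (y + 1)) = 2 * j ∧
      fold n (x + 1 + (y + 2)) = 2 * (j + 1) ∧ fold n (x + 1 + y) = 2 * j ∨
    fold n (x + 2 + (y + 1)) = 2 * j ∧ fold n (x + (y + 1)) = 2 * (j + 1) ∧
      fold n (x + 1 + (y + 2)) = 2 * j ∧ fold n (x + 1 + y) = 2 * (j + 1) := by
  unfold fold at hj ⊢; omega

theorem dist_neighbours {x y k : ℕ} (hk : x + 1 - (y + 1) + (y + 1 - (x + 1)) = 2 * k + 1) :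
    x + 2 - (y + 1) + (y + 1 - (x + 2)) = 2 * (k + 1) ∧ x - (y + 1) + (y + 1 - x) = 2 * k ∧
      x + 1 - (y + 2) + (y + 2 - (x + 1)) = 2 * k ∧
      x + 1 - y + (y - (x + 1)) = 2 * (k + 1) ∨
    x + 2 - (y + 1) + (y + 1 - (x + 2)) = 2 * k ∧ x - (y + 1) + (y + 1 - x) = 2 * (k + 1) ∧
      x + 1 - (y + 2) + (y + 2 - (x + 1)) = 2 * (k + 1) ∧ x + 1 - y + (y - (x + 1)) = 2 * k := by
  omega

theorem IsAmbiguous.weight_sum (h : IsAmbiguous n s₁ s₂) (hn : n % 2 = 0) {x y : ℕ}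
    (hx : x + 2 ≤ n) (hy : y + 2 ≤ n) (hxy : (x + y) % 2 = 1) :
    ((cellDiff s₁ s₂ (x + 2) (y + 1) ^^ cellDiff s₁ s₂ (x + 1) (y + 1)).toNat : ℤ) *
        weight n s₁ s₂ (x + 2) (y + 1) +
      (cellDiff s₁ s₂ x (y + 1) ^^ cellDiff s₁ s₂ (x + 1) (y + 1)).toNat *
        weight n s₁ s₂ x (y + 1) +
      (cellDiff s₁ s₂ (x + 1) (y + 2) ^^ cellDiff s₁ s₂ (x + 1) (y + 1)).toNat *
        weight n s₁ s₂ (x + 1) (y + 2) +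
      (cellDiff s₁ s₂ (x + 1) y ^^ cellDiff s₁ s₂ (x + 1) (y + 1)).toNat *
        weight n s₁ s₂ (x + 1) y = 0 := by
  rw [h.cellDiff_eq (y + 1) (by omega) (x + 2) (by omega),
    h.cellDiff_eq (y + 1) (by omega) (x + 1) (by omega),
    h.cellDiff_eq (y + 1) (by omega) x (by omega),
    h.cellDiff_eq (y + 2) (by omega) (x + 1) (by omega),
    h.cellDiff_eq y (by omega) (x + 1) (by omega)]
  obtain ⟨j, hj⟩ : ∃ j, fold n (x + 1 + (y + 1)) = 2 * j + 1 :=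
    ⟨fold n (x + 1 + (y + 1)) / 2, by unfold fold; omega⟩
  obtain ⟨k, hk⟩ : ∃ k, x + 1 - (y + 1) + (y + 1 - (x + 1)) = 2 * k + 1 :=
    ⟨(x - y + (y - x)) / 2, by omega⟩
  have aux := weight_sum_aux (s₁ := s₁) (s₂ := s₂) j k
  have hu := fold_neighbours hn hx hy hj
  have hv := dist_neighbours hk
  rw [hj, hk]
  rcases hu with ⟨u1, u2, u3, u4⟩ | ⟨u1, u2, u3, u4⟩ <;>
  rcases hv with ⟨v1, v2, v3, v4⟩ | ⟨v1, v2, v3, v4⟩ <;>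
  · rw [weight_eq u1 v1, weight_eq u2 v2, weight_eq u3 v3, weight_eq u4 v4, u1, u2, u3, u4, v1, v2,
      v3, v4]
    rw [show 2 * (j + 1) = 2 * j + 2 from rfl, show 2 * (k + 1) = 2 * k + 2 from rfl]
    linear_combination (exp := 1) aux

/-- The variation of the letters around the `k`-th boundary edge, for `k` odd. -/
def letterStep (s₁ s₂ : ℕ → ℕ → Bool) (k : ℕ) : ℤ :=
  if k % 2 = 1 then (letter s₁ s₂ (k + 1)).toNat - (letter s₁ s₂ k).toNat else 0

theorem imPow_step : ∀ a b c : Bool,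
    ((c ^^ a).toNat : ℤ) * imPow (2 + (b ^^ a).toNat - (c ^^ b).toNat) =
      (c ^^ b).toNat - (b ^^ a).toNat := by
  decide

/-- The index hypotheses describe the cells next to the boundary, where the two diagonals are
consecutive of the same parity and the phase difference is a single step. -/
theorem IsAmbiguous.weight_step (h : IsAmbiguous n s₁ s₂) {x y k : ℕ}
    (hx : x ≤ n) (hy : y ≤ n) (hu : fold n (x + y) = k + 1) (hv : x - y + (y - x) + 1 = k) :
    ((cellDiff s₁ s₂ x y).toNat : ℤ) * weight n s₁ s₂ x y = letterStep s₁ s₂ k := by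
  rcases Nat.mod_two_eq_zero_or_one k with hk | hk
  · rw [weight_of_odd (by omega), mul_zero, letterStep, if_neg (by omega)]
  · obtain ⟨m, rfl⟩ : ∃ m, k = 2 * m + 1 := ⟨k / 2, by omega⟩
    rw [weight_eq (J := m + 1) (K := m) hu (by omega), h.cellDiff_eq y hy x hx, hu,
      show x - y + (y - x) = 2 * m by omega, letterStep, if_pos hk, phase_succ]
    have := imPow_step (diag s₁ s₂ (2 * m)) (diag s₁ s₂ (2 * m + 1)) (diag s₁ s₂ (2 * m + 2))
    convert this using 3 <;> first | rfl | ring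

/-- Two cells with a common edge. -/
def Touch (p q : ℕ × ℕ) : Prop :=
  p.2 = q.2 ∧ (p.1 = q.1 + 1 ∨ q.1 = p.1 + 1) ∨ p.1 = q.1 ∧ (p.2 = q.2 + 1 ∨ q.2 = p.2 + 1)

instance : DecidableRel Touch := fun _ _ => inferInstanceAs (Decidable (_ ∨ _))

theorem Touch.comm {p q : ℕ × ℕ} : Touch p q ↔ Touch q p := by
  unfold Touch; omega

theorem sum_touch (F : ℕ × ℕ → ℤ) {x y : ℕ} (hx : x + 2 ≤ n) (hy : y + 2 ≤ n) :
    (∑ q ∈ Finset.range (n + 1) ×ˢ Finset.range (n + 1), if Touch (x + 1, y + 1) q then F q else 0) =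
      F (x + 2, y + 1) + F (x, y + 1) + F (x + 1, y + 2) + F (x + 1, y) := by
  rw [← Finset.sum_filter]
  have : (Finset.range (n + 1) ×ˢ Finset.range (n + 1)).filter (Touch (x + 1, y + 1)) =
      {(x + 2, y + 1), (x, y + 1), (x + 1, y + 2), (x + 1, y)} := by
    ext ⟨a, b⟩
    simp only [Finset.mem_filter, Finset.mem_product, Finset.mem_range, Touch, Finset.mem_insert,
      Finset.mem_singleton, Prod.mk.injEq]
    omega
  rw [this, Finset.sum_insert (by simp), Finset.sum_insert (by simp), Finset.sum_insert (by simp),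
    Finset.sum_singleton]
  ring

/-- The contribution of a pair of adjacent cells to the weighted sum of the signature
conditions. -/
def pairTerm (n : ℕ) (s₁ s₂ : ℕ → ℕ → Bool) (p q : ℕ × ℕ) : ℤ :=
  (cellDiff s₁ s₂ p.1 p.2 ^^ cellDiff s₁ s₂ q.1 q.2).toNat * weight n s₁ s₂ p.1 p.2 *
    spin (s₁ q.1 q.2)

theorem sum_square (f : ℕ → ℕ → ℤ) (N : ℕ) :
    ∑ p ∈ Finset.range (N + 3) ×ˢ Finset.range (N + 3), f p.1 p.2 =
      f 0 0 + f 0 (N + 2) + f (N + 2) 0 + f (N + 2) (N + 2) +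
      ∑ x ∈ Finset.range (N + 1), (f 0 (x + 1) + f (N + 2) (x + 1) + f (x + 1) 0 +
        f (x + 1) (N + 2)) +
      ∑ x ∈ Finset.range (N + 1), ∑ y ∈ Finset.range (N + 1), f (x + 1) (y + 1) := by
  have key : ∀ g : ℕ → ℤ, ∑ x ∈ Finset.range (N + 3), g x =
      g 0 + g (N + 2) + ∑ x ∈ Finset.range (N + 1), g (x + 1) := by
    intro g
    rw [Finset.sum_range_succ, Finset.sum_range_succ']
    ring
  rw [Finset.sum_product, key]
  simp only [key, Finset.sum_add_distrib]
  ring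

/-- Summation with the weighted cell fixed: boundary weights vanish, and at an interior cell this is
a multiple of `spin_sum`. -/
theorem IsAmbiguous.sum_pairTerm_left (h : IsAmbiguous n s₁ s₂) (hn : n % 2 = 0) {p : ℕ × ℕ}
    (hp : p ∈ Finset.range (n + 1) ×ˢ Finset.range (n + 1)) :
    (∑ q ∈ Finset.range (n + 1) ×ˢ Finset.range (n + 1),
      if Touch p q then pairTerm n s₁ s₂ p q else 0) = 0 := by
  obtain ⟨x, y⟩ := p
  simp only [Finset.mem_product, Finset.mem_range] at hp
  by_cases hb : x = 0 ∨ x = n ∨ y = 0 ∨ y = n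
  · refine Finset.sum_eq_zero fun q _ => ?_
    simp [pairTerm, weight_boundary hn (by omega : x ≤ n) (by omega : y ≤ n) hb]
  · obtain ⟨x, rfl⟩ : ∃ k, x = k + 1 := ⟨x - 1, by omega⟩
    obtain ⟨y, rfl⟩ : ∃ k, y = k + 1 := ⟨y - 1, by omega⟩
    rw [sum_touch _ (by omega) (by omega)]
    have := h.spin_sum (x := x) (y := y) (by omega) (by omega)
    simp only [pairTerm, Bool.xor_comm (cellDiff s₁ s₂ (x + 1) (y + 1))]
    linear_combination weight n s₁ s₂ (x + 1) (y + 1) * this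

/-- The terms of the weighted sum which contain the spin of a fixed cell. -/
def colSum (n : ℕ) (s₁ s₂ : ℕ → ℕ → Bool) (x y : ℕ) : ℤ :=
  ∑ p ∈ Finset.range (n + 1) ×ˢ Finset.range (n + 1),
    if Touch p (x, y) then pairTerm n s₁ s₂ p (x, y) else 0

/-- Summation with the spin fixed: neighbours of an even cell carry no weight, and at an odd cell
this is a multiple of `weight_sum`. -/
theorem IsAmbiguous.colSum_interior (h : IsAmbiguous n s₁ s₂) (hn : n % 2 = 0) {x y : ℕ}
    (hx : x + 2 ≤ n) (hy : y + 2 ≤ n) : colSum n s₁ s₂ (x + 1) (y + 1) = 0 := by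
  simp only [colSum, Touch.comm (q := (x + 1, y + 1))]
  rw [sum_touch _ hx hy]
  simp only [pairTerm]
  rcases Nat.mod_two_eq_zero_or_one (x + y) with hxy | hxy
  · rw [weight_of_odd (by omega), weight_of_odd (by omega), weight_of_odd (by omega),
      weight_of_odd (by omega)]
    ring
  · linear_combination spin (s₁ (x + 1) (y + 1)) * h.weight_sum hn hx hy hxy

/-- A non-corner boundary cell has a single interior neighbour `(a, b)`. The boundary cell itself is
outside, so it has difference bit zero and spin `1`. -/
theorem IsAmbiguous.colSum_boundary (h : IsAmbiguous n s₁ s₂) (hn : n % 2 = 0) {x y a b k : ℕ}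
    (hx : x ≤ n) (hy : y ≤ n) (hxy : x = 0 ∨ x = n ∨ y = 0 ∨ y = n) (ht : Touch (a, b) (x, y))
    (ha : 1 ≤ a) (hb : 1 ≤ b) (ha' : a + 1 ≤ n) (hb' : b + 1 ≤ n)
    (hu : fold n (a + b) = k + 1) (hv : a - b + (b - a) + 1 = k) :
    colSum n s₁ s₂ x y = letterStep s₁ s₂ k := by
  rw [colSum, Finset.sum_eq_single (a, b), if_pos ht, pairTerm, h.cellDiff_eq_zero hxy,
    Bool.xor_false, h.weight_step (by omega) (by omega) hu hv]
  · have : s₁ x y = false := by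
      rcases hxy with rfl | rfl | rfl | rfl <;> simp [h.bot, h.top, h.left, h.right]
    rw [this, spin, cond_false, mul_one]
  · rintro ⟨c, d⟩ hp hne
    simp only [Finset.mem_product, Finset.mem_range] at hp
    split_ifs with hcd
    · rw [pairTerm, weight_boundary hn (by omega) (by omega), mul_zero, zero_mul]
      unfold Touch at *
      simp only [ne_eq, Prod.mk.injEq] at *
      omega
    · rfl
  · simp; omega

theorem colSum_corner (hn : n % 2 = 0) {x y : ℕ} (hx : x = 0 ∨ x = n) (hy : y = 0 ∨ y = n) :
    colSum n s₁ s₂ x y = 0 := by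
  refine Finset.sum_eq_zero fun p _ => ?_
  split_ifs with hp
  · rw [pairTerm, weight_of_odd, mul_zero, zero_mul]
    unfold Touch at hp
    simp only at hp
    omega
  · rfl

/-- Double counting of the pair terms: one order gives zero, the other gives each letter step four
times, once from every side of the grid. -/
theorem IsAmbiguous.sum_letterStep (h : IsAmbiguous n s₁ s₂) (hn : n % 2 = 0) (hn2 : 2 ≤ n) :
    ∑ k ∈ Finset.range n, letterStep s₁ s₂ k = 0 := by
  have h0 : ∑ q ∈ Finset.range (n + 1) ×ˢ Finset.range (n + 1), colSum n s₁ s₂ q.1 q.2 = 0 := by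
    simp only [colSum]
    rw [Finset.sum_comm]
    exact Finset.sum_eq_zero fun p hp => h.sum_pairTerm_left hn hp
  obtain ⟨N, rfl⟩ : ∃ N, n = N + 2 := ⟨n - 2, by omega⟩
  rw [sum_square (colSum (N + 2) s₁ s₂), colSum_corner hn (by simp) (by simp),
    colSum_corner hn (by simp) (by simp), colSum_corner hn (by simp) (by simp),
    colSum_corner hn (by simp) (by simp)] at h0
  have h1 : ∀ x ∈ Finset.range (N + 1), ∀ y ∈ Finset.range (N + 1),
      colSum (N + 2) s₁ s₂ (x + 1) (y + 1) = 0 := by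
    intro x hx y hy
    rw [Finset.mem_range] at hx hy
    exact h.colSum_interior hn (by omega) (by omega)
  rw [Finset.sum_eq_zero fun x hx => Finset.sum_eq_zero (h1 x hx)] at h0
  -- The left and lower sides carry step `x + 1`, the right and upper sides the reversed index,
  -- written in the form that `Finset.sum_range_reflect` expects.
  have h2 : ∀ x ∈ Finset.range (N + 1), colSum (N + 2) s₁ s₂ 0 (x + 1) +
      colSum (N + 2) s₁ s₂ (N + 2) (x + 1) + colSum (N + 2) s₁ s₂ (x + 1) 0 +
      colSum (N + 2) s₁ s₂ (x + 1) (N + 2) = 2 * letterStep s₁ s₂ (x + 1) +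
        2 * letterStep s₁ s₂ (N + 1 - 1 - x + 1) := by
    intro x hx
    rw [Finset.mem_range] at hx
    rw [h.colSum_boundary hn (a := 1) (b := x + 1) (k := x + 1) (by omega) (by omega) (by omega)
        (by simp [Touch]) (by omega) (by omega) (by omega) (by omega) (by unfold fold; omega)
        (by omega),
      h.colSum_boundary hn (a := N + 1) (b := x + 1) (k := N + 1 - 1 - x + 1) (by omega) (by omega)
        (by omega) (by simp [Touch]) (by omega) (by omega) (by omega) (by omega)
        (by unfold fold; omega) (by omega),
      h.colSum_boundary hn (a := x + 1) (b := 1) (k := x + 1) (by omega) (by omega) (by omega)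
        (by simp [Touch]) (by omega) (by omega) (by omega) (by omega) (by unfold fold; omega)
        (by omega),
      h.colSum_boundary hn (a := x + 1) (b := N + 1) (k := N + 1 - 1 - x + 1) (by omega) (by omega)
        (by omega) (by simp [Touch]) (by omega) (by omega) (by omega) (by omega)
        (by unfold fold; omega) (by omega)]
    ring
  rw [Finset.sum_congr rfl h2, Finset.sum_add_distrib, ← Finset.mul_sum, ← Finset.mul_sum,
    Finset.sum_range_reflect (fun x => letterStep s₁ s₂ (x + 1))] at h0
  rw [Finset.sum_range_succ']
  have : letterStep s₁ s₂ 0 = 0 := rfl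
  linarith

theorem card_letterSet (n : ℕ) (s₁ s₂ : ℕ → ℕ → Bool) :
    ((letterSet n s₁ s₂ true).card : ℤ) =
      ∑ k ∈ Finset.range n, ((letter s₁ s₂ (k + 1)).toNat : ℤ) := by
  rw [letterSet, Finset.card_filter, Finset.range_eq_Ico,
    Finset.sum_Ico_add' (fun k => ((letter s₁ s₂ k).toNat : ℤ)), zero_add,
    Finset.Ico_add_one_right_eq_Icc]
  push_cast
  refine Finset.sum_congr rfl fun k _ => ?_
  cases letter s₁ s₂ k <;> rfl

theorem IsAmbiguous.even_card_letterSet (h : IsAmbiguous n s₁ s₂) (hn : n % 2 = 0)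
    (hn2 : 2 ≤ n) : Even (letterSet n s₁ s₂ true).card := by
  have h0 := h.sum_letterStep hn hn2
  obtain ⟨m, rfl⟩ : ∃ m, n = 2 * m := ⟨n / 2, by omega⟩
  -- Grouping the letters in pairs `2m + 1`, `2m + 2`: the sum of a pair is twice its first letter
  -- plus the letter step.
  have key : ∀ m : ℕ, ∃ t : ℤ, ∑ k ∈ Finset.range (2 * m), ((letter s₁ s₂ (k + 1)).toNat : ℤ) =
      2 * t + ∑ k ∈ Finset.range (2 * m), letterStep s₁ s₂ k := by
    intro m
    induction m with
    | zero => exact ⟨0, by simp⟩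
    | succ m ih =>
      obtain ⟨t, ht⟩ := ih
      refine ⟨t + (letter s₁ s₂ (2 * m + 1)).toNat, ?_⟩
      rw [show 2 * (m + 1) = 2 * m + 1 + 1 by ring, Finset.sum_range_succ, Finset.sum_range_succ,
        ht, Finset.sum_range_succ, Finset.sum_range_succ, letterStep, if_neg (by omega),
        letterStep, if_pos (by omega)]
      ring
  obtain ⟨t, ht⟩ := key m
  rw [h0, ← card_letterSet] at ht
  rw [← Int.even_coe_nat, ht, add_zero]
  exact even_two_mul t

/-! ### The numerical upper bound -/

/-- `4ab = n² - (a - b)²`. For odd `n` the square is at least `1`. For even `n` both numbers are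
even, and if `n ≡ 2` mod `4` their halves differ, so the square is at least `4`. -/
theorem four_mul_le_of_even {a b n : ℕ} (hab : a + b = n) (h : n % 2 = 0 → Even a) :
    4 * (a * b) ≤ n ^ 2 - n ^ 2 % 8 := by
  subst hab
  rcases Nat.mod_two_eq_zero_or_one (a + b) with hn | hn
  · obtain ⟨c, hc⟩ := h hn
    obtain ⟨d, hd⟩ : ∃ d, b = d + d := ⟨b / 2, by omega⟩
    subst hc hd
    rcases Nat.mod_two_eq_zero_or_one (c + d) with h2 | h2
    · obtain ⟨e, he⟩ : ∃ e, c + d = 2 * e := ⟨(c + d) / 2, by omega⟩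
      have h3 : (c + c + (d + d)) ^ 2 = 8 * (2 * e ^ 2) := by
        rw [show c + c + (d + d) = 2 * (c + d) by ring, he]; ring
      have : (c + c + (d + d)) ^ 2 % 8 = 0 := by rw [h3]; omega
      rw [this, Nat.sub_zero]
      zify
      nlinarith [sq_nonneg ((c : ℤ) - d)]
    · obtain ⟨e, he⟩ : ∃ e, c + d = 2 * e + 1 := ⟨(c + d) / 2, by omega⟩
      have h3 : (c + c + (d + d)) ^ 2 = 8 * (2 * e ^ 2 + 2 * e) + 4 := by
        rw [show c + c + (d + d) = 2 * (c + d) by ring, he]; ring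
      have h4 : (c + c + (d + d)) ^ 2 % 8 = 4 := by rw [h3]; omega
      rw [h4]
      apply Nat.le_sub_of_add_le
      zify
      have h5 : 1 ≤ ((c : ℤ) - d) ^ 2 := by
        have : (c : ℤ) - d ≠ 0 := by omega
        have := sq_pos_of_ne_zero this
        linarith
      nlinarith
  · obtain ⟨e, he⟩ : ∃ e, a + b = 2 * e + 1 := ⟨(a + b) / 2, by omega⟩
    have h3 : (a + b) ^ 2 % 8 = 1 := by
      obtain ⟨f, hf⟩ := Nat.even_mul_succ_self e
      rw [he, show (2 * e + 1) ^ 2 = 4 * (e * (e + 1)) + 1 by ring]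
      rw [hf]; omega
    rw [h3]
    apply Nat.le_sub_of_add_le
    zify
    have h5 : 1 ≤ ((a : ℤ) - b) ^ 2 := by
      have : (a : ℤ) - b ≠ 0 := by omega
      have := sq_pos_of_ne_zero this
      linarith
    nlinarith

/-- Two cycles with the same signature differ in at most `n ^ 2 - n ^ 2 % 8` edges. -/
theorem card_symmDiff_le_of_signature_eq (hn : 2 ≤ n) {C₁ C₂ : Finset (Sym2 (ℤ × ℤ))}
    (hC₁ : IsCycleEdgeSet (gridGraph n n) C₁) (hC₂ : IsCycleEdgeSet (gridGraph n n) C₂)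
    (h : signature n n C₁ = signature n n C₂) : (symmDiff C₁ C₂).card ≤ n ^ 2 - n ^ 2 % 8 := by
  obtain ⟨s₁, h₁⟩ := exists_isFilling hC₁
  obtain ⟨s₂, h₂⟩ := exists_isFilling hC₂
  have hA := h₁.isAmbiguous h₂ h
  exact (card_symmDiff_le hC₁ hC₂ h₁ h₂ hA).trans
    (four_mul_le_of_even (card_letterSet_add n s₁ s₂) fun h0 => hA.even_card_letterSet h0 hn)

/-! ### The edges of the extremal cycles and their degrees -/

/-- The index set of the edges in which the two extremal cycles differ. -/
def InStrip (a b u v : ℤ) : Prop := 0 ≤ u ∧ u < 2 * a ∧ 0 ≤ v ∧ v < 2 * b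

/-- The horizontal edges common to both extremal cycles. -/
def CommonHor (a b x y : ℤ) : Prop :=
  y = x + b + 1 ∧ x % 2 = 1 ∧ 1 ≤ x ∧ x + 1 ≤ a ∨
  x = b + y ∧ y % 2 = 0 ∧ 2 ≤ y ∧ y + 2 ≤ a ∨ y = 1 ∧ b + 1 ≤ x ∧ x + 1 ≤ a + b

/-- The vertical edges common to both extremal cycles. -/
def CommonVer (a b x y : ℤ) : Prop :=
  y = b + x ∧ x % 2 = 1 ∧ 1 ≤ x ∧ x + 1 ≤ a ∨
  x = b + y + 1 ∧ y % 2 = 0 ∧ 2 ≤ y ∧ y + 2 ≤ a ∨ x = a + b ∧ 1 ≤ y ∧ y + 1 ≤ a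

/-- The left ends of the horizontal edges of an extremal cycle. -/
def Hor (a b σ x y : ℤ) : Prop :=
  InStrip a b (x + y - 1 - b) (x - y + b) ∧ (x + y - 1 - b + (x - y + b) / 2) % 2 = σ ∨
    CommonHor a b x y

/-- The lower ends of the vertical edges of an extremal cycle. -/
def Ver (a b σ x y : ℤ) : Prop :=
  InStrip a b (x + y - 1 - b) (x - y + b - 1) ∧ (x + y - 1 - b + (x - y + b - 1) / 2) % 2 = σ ∨
    CommonVer a b x y

variable {a b : ℤ}

theorem Hor.bounds {x y : ℤ} (hb : 1 ≤ b) (h : Hor a b 0 x y) :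
    1 ≤ x ∧ x + 1 ≤ a + b ∧ 1 ≤ y ∧ y ≤ a + b := by
  unfold Hor InStrip CommonHor at h; omega

theorem Ver.bounds {x y : ℤ} (hb : 1 ≤ b) (h : Ver a b 0 x y) :
    1 ≤ x ∧ x ≤ a + b ∧ 1 ≤ y ∧ y + 1 ≤ a + b := by
  unfold Ver InStrip CommonVer at h; omega

theorem hor_of_strip {x y : ℤ} (h : 0 ≤ x - y + b) (h' : x - y < b) :
    Hor a b 0 x y ↔
      1 ≤ x + y - b ∧ x + y - b ≤ 2 * a ∧ (x + y - 1 - b + (x - y + b) / 2) % 2 = 0 := by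
  constructor
  · rintro (⟨h1, h2⟩ | h1)
    · unfold InStrip at h1; omega
    · unfold CommonHor at h1; omega
  · rintro ⟨h1, h2, h3⟩
    exact Or.inl ⟨⟨by omega, by omega, by omega, by omega⟩, h3⟩

theorem ver_of_strip {x y : ℤ} (h : 1 ≤ x - y + b) (h' : x - y ≤ b) :
    Ver a b 0 x y ↔
      1 ≤ x + y - b ∧ x + y - b ≤ 2 * a ∧ (x + y - 1 - b + (x - y + b - 1) / 2) % 2 = 0 := by
  constructor
  · rintro (⟨h1, h2⟩ | h1)
    · unfold InStrip at h1; omega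
    · unfold CommonVer at h1; omega
  · rintro ⟨h1, h2, h3⟩
    exact Or.inl ⟨⟨by omega, by omega, by omega, by omega⟩, h3⟩

theorem hor_of_not_strip {x y : ℤ} (h : x - y + b < 0 ∨ b ≤ x - y) :
    Hor a b 0 x y ↔ CommonHor a b x y := by
  refine ⟨fun h1 => h1.resolve_left fun h2 => ?_, Or.inr⟩
  unfold InStrip at h2; omega

theorem ver_of_not_strip {x y : ℤ} (h : x - y + b < 1 ∨ b < x - y) :
    Ver a b 0 x y ↔ CommonVer a b x y := by
  refine ⟨fun h1 => h1.resolve_left fun h2 => ?_, Or.inr⟩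
  unfold InStrip at h2; omega

/-- Either none or exactly two of four propositions hold. -/
def NoneOrTwo (p q r s : Prop) : Prop :=
  ¬p ∧ ¬q ∧ ¬r ∧ ¬s ∨ p ∧ q ∧ ¬r ∧ ¬s ∨ p ∧ ¬q ∧ r ∧ ¬s ∨ p ∧ ¬q ∧ ¬r ∧ s ∨ ¬p ∧ q ∧ r ∧ ¬s ∨
    ¬p ∧ q ∧ ¬r ∧ s ∨ ¬p ∧ ¬q ∧ r ∧ s

/-- The cases place the vertex before, on, between, on and beyond the two long sides of the strip.
Inside, two edges of one zigzag meet; on a side, a path end meets one common edge; outside there are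
only common edges. -/
theorem noneOrTwo_incident (ha : a % 2 = 0) (ha2 : 2 ≤ a) (hb : 1 ≤ b) (x y : ℤ) :
    NoneOrTwo (Hor a b 0 x y) (Ver a b 0 x y) (Hor a b 0 (x - 1) y) (Ver a b 0 x (y - 1)) := by
  rcases (by omega : x - y + b < 0 ∨ x - y + b = 0 ∨ 1 ≤ x - y + b ∧ x - y + b < 2 * b ∨
    x - y + b = 2 * b ∨ 2 * b < x - y + b) with h | h | h | h | h
  · rw [hor_of_not_strip (by omega), hor_of_not_strip (by omega), ver_of_not_strip (by omega),
      ver_of_not_strip (by omega)]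
    unfold CommonHor CommonVer
    by_cases h1 : y = x + b + 1 ∧ x % 2 = 1 ∧ 1 ≤ x ∧ x + 1 ≤ a
    · exact .inr <| .inr <| .inr <| .inl ⟨by omega, by omega, by omega, by omega⟩
    · exact .inl ⟨by omega, by omega, by omega, by omega⟩
  · rw [hor_of_strip (by omega) (by omega), hor_of_not_strip (by omega),
      ver_of_not_strip (by omega), ver_of_strip (by omega) (by omega)]
    unfold CommonHor CommonVer
    by_cases h1 : 1 ≤ x ∧ x ≤ a
    · rcases Int.emod_two_eq_zero_or_one x with h2 | h2
      · exact .inr <| .inr <| .inr <| .inr <| .inr <| .inr ⟨by omega, by omega, by omega, by omega⟩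
      · exact .inr <| .inr <| .inr <| .inr <| .inr <| .inl ⟨by omega, by omega, by omega, by omega⟩
    · exact .inl ⟨by omega, by omega, by omega, by omega⟩
  · rw [hor_of_strip (by omega) (by omega), hor_of_strip (by omega) (by omega),
      ver_of_strip (by omega) (by omega), ver_of_strip (by omega) (by omega)]
    by_cases hR : 1 ≤ x + y - b ∧ x + y - b ≤ 2 * a ∧ (x + y - 1 - b + (x - y + b) / 2) % 2 = 0 <;>
    by_cases hU : 1 ≤ x + y - b ∧ x + y - b ≤ 2 * a ∧ (x + y - 1 - b + (x - y + b - 1) / 2) % 2 = 0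
    · exact .inr <| .inl ⟨hR, hU, by omega, by omega⟩
    · exact .inr <| .inr <| .inl ⟨hR, hU, by omega, by omega⟩
    · exact .inr <| .inr <| .inr <| .inr <| .inr <| .inl ⟨hR, hU, by omega, by omega⟩
    · by_cases hL : 1 ≤ x - 1 + y - b ∧ x - 1 + y - b ≤ 2 * a ∧ (x - 1 + y - 1 - b + (x - 1 - y + b) / 2) % 2 = 0
      · exact .inr <| .inr <| .inr <| .inr <| .inr <| .inr ⟨hR, hU, hL, by omega⟩
      · exact .inl ⟨hR, hU, hL, by omega⟩
  · rw [hor_of_not_strip (by omega), hor_of_strip (by omega) (by omega),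
      ver_of_strip (by omega) (by omega), ver_of_not_strip (by omega)]
    unfold CommonHor CommonVer
    by_cases h1 : 1 ≤ y ∧ y ≤ a
    · rcases Int.emod_two_eq_zero_or_one b with h2 | h2 <;>
      by_cases h3 : y % 2 = 0 ∧ y + 2 ≤ a ∨ y = 1
      · exact .inr <| .inl ⟨by omega, by omega, by omega, by omega⟩
      · exact .inr <| .inr <| .inr <| .inr <| .inr <| .inl ⟨by omega, by omega, by omega, by omega⟩
      · exact .inr <| .inr <| .inl ⟨by omega, by omega, by omega, by omega⟩
      · exact .inr <| .inr <| .inr <| .inr <| .inr <| .inr ⟨by omega, by omega, by omega, by omega⟩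
    · exact .inl ⟨by omega, by omega, by omega, by omega⟩
  · rw [hor_of_not_strip (by omega), hor_of_not_strip (by omega), ver_of_not_strip (by omega),
      ver_of_not_strip (by omega)]
    unfold CommonHor CommonVer
    by_cases h1 : x = b + y + 1 ∧ y % 2 = 0 ∧ 2 ≤ y ∧ y + 2 ≤ a ∨ y = 1 ∧ x = a + b
    · exact .inr <| .inr <| .inr <| .inr <| .inl ⟨by omega, by omega, by omega, by omega⟩
    · by_cases h2 : y = 1 ∧ x < a + b
      · exact .inr <| .inr <| .inl ⟨by omega, by omega, by omega, by omega⟩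
      · by_cases h3 : x = a + b ∧ 2 ≤ y ∧ y + 1 ≤ a
        · exact .inr <| .inr <| .inr <| .inr <| .inr <| .inl ⟨by omega, by omega, by omega, by omega⟩
        · exact .inl ⟨by omega, by omega, by omega, by omega⟩

/-! ### From degrees and connectedness to a cycle -/

/-- A finite connected graph all of whose vertices have degree `0` or `2` is a cycle, up to
isolated vertices. -/
theorem exists_isCycle_mem_edges {V : Type*} {G : SimpleGraph V} {s : Set V} [Finite s]
    (hs : ∀ p q, G.Adj p q → p ∈ s) (hG : G.IsCycles) {v v' : V} (hv : G.Adj v v')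
    (hc : ∀ p q, G.Adj p q → G.Reachable v p) :
    ∃ (u : V) (c : G.Walk u u), c.IsCycle ∧ ∀ e, e ∈ c.edges ↔ e ∈ G.edgeSet := by
  classical
  have _ : Fintype s := Fintype.ofFinite s
  -- Restriction to `s` gives a finite vertex type; no edge is lost, since all edges have their ends
  -- in `s`.
  set H := G.induce s with hH
  have hnb : ∀ p : s, Subtype.val '' H.neighborSet p = G.neighborSet p := by
    intro p
    ext q
    simp only [Set.mem_image, SimpleGraph.mem_neighborSet]
    exact ⟨by rintro ⟨q, hq, rfl⟩; exact hq, fun hq => ⟨⟨q, hs _ _ hq.symm⟩, hq, rfl⟩⟩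
  have hcyc : H.IsCycles := by
    intro p hp
    rw [← Set.ncard_image_of_injective _ Subtype.val_injective, hnb]
    exact hG (hnb p ▸ hp.image _)
  have hvs : v ∈ s := hs _ _ hv
  have hre : ∀ p q (w : G.Walk p q) (hp : p ∈ s), ∃ hq : q ∈ s, H.Reachable ⟨p, hp⟩ ⟨q, hq⟩ := by
    intro p q w
    induction w with
    | nil => exact fun hp => ⟨hp, .rfl⟩
    | cons h w ih =>
      intro hp
      obtain ⟨hq, hr⟩ := ih (hs _ _ h.symm)
      refine ⟨hq, SimpleGraph.Reachable.trans (SimpleGraph.Adj.reachable ?_) hr⟩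
      exact h
  have hv' : H.Adj ⟨v, hvs⟩ ⟨v', hs _ _ hv.symm⟩ := hv
  obtain ⟨c, hc1, hc2⟩ := hcyc.exists_cycle_toSubgraph_verts_eq_connectedComponentSupp
    (c := H.connectedComponentMk ⟨v, hvs⟩) (v := ⟨v, hvs⟩) rfl ⟨_, hv'⟩
  refine ⟨_, c.map (SimpleGraph.Embedding.induce s).toHom,
    hc1.map Subtype.val_injective, fun e => ?_⟩
  constructor
  · exact fun he => SimpleGraph.Walk.edges_subset_edgeSet _ he
  · induction e using Sym2.ind with
    | _ p q =>
      intro h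
      rw [SimpleGraph.mem_edgeSet] at h
      obtain ⟨w⟩ := hc p q h
      obtain ⟨hp, hr⟩ := hre _ _ w hvs
      have hmem : (⟨p, hp⟩ : s) ∈ c.toSubgraph.verts := by
        rw [hc2]
        exact SimpleGraph.ConnectedComponent.sound hr.symm
      have := (hc1.adj_toSubgraph_iff_of_isCycles hcyc hmem ⟨q, hs _ _ h.symm⟩).2 h
      rw [SimpleGraph.Walk.edges_map, List.mem_map]
      exact ⟨s(⟨p, hp⟩, ⟨q, _⟩), SimpleGraph.Walk.adj_toSubgraph_iff_mem_edges.1 this, rfl⟩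

/-- The graph formed by the edges of an extremal cycle. -/
def extremalGraph (a b : ℤ) : SimpleGraph (ℤ × ℤ) where
  Adj p q :=
    p.2 = q.2 ∧ (q.1 = p.1 + 1 ∧ Hor a b 0 p.1 p.2 ∨ p.1 = q.1 + 1 ∧ Hor a b 0 q.1 q.2) ∨
    p.1 = q.1 ∧ (q.2 = p.2 + 1 ∧ Ver a b 0 p.1 p.2 ∨ p.2 = q.2 + 1 ∧ Ver a b 0 q.1 q.2)
  symm := ⟨fun p q h => by
    rcases h with ⟨h1, h2⟩ | ⟨h1, h2⟩
    · exact Or.inl ⟨h1.symm, h2.symm⟩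
    · exact Or.inr ⟨h1.symm, h2.symm⟩⟩
  loopless := ⟨fun p h => by omega⟩

theorem extremalGraph_adj_iff {x y : ℤ} {q : ℤ × ℤ} :
    (extremalGraph a b).Adj (x, y) q ↔ q = (x + 1, y) ∧ Hor a b 0 x y ∨
      q = (x, y + 1) ∧ Ver a b 0 x y ∨ q = (x - 1, y) ∧ Hor a b 0 (x - 1) y ∨
      q = (x, y - 1) ∧ Ver a b 0 x (y - 1) := by
  obtain ⟨x', y'⟩ := q
  simp only [extremalGraph, Prod.mk.injEq]
  constructor
  · rintro (⟨rfl, ⟨rfl, h⟩ | ⟨rfl, h⟩⟩ | ⟨rfl, ⟨rfl, h⟩ | ⟨rfl, h⟩⟩)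
    · exact .inl ⟨⟨rfl, rfl⟩, h⟩
    · exact .inr <| .inr <| .inl ⟨⟨by omega, rfl⟩, by rwa [add_sub_cancel_right]⟩
    · exact .inr <| .inl ⟨⟨rfl, rfl⟩, h⟩
    · exact .inr <| .inr <| .inr ⟨⟨rfl, by omega⟩, by rwa [add_sub_cancel_right]⟩
  · rintro (⟨⟨rfl, rfl⟩, h⟩ | ⟨⟨rfl, rfl⟩, h⟩ | ⟨⟨rfl, rfl⟩, h⟩ | ⟨⟨rfl, rfl⟩, h⟩)
    · exact .inl ⟨rfl, .inl ⟨rfl, h⟩⟩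
    · exact .inr ⟨rfl, .inl ⟨rfl, h⟩⟩
    · exact .inl ⟨rfl, .inr ⟨by omega, h⟩⟩
    · exact .inr ⟨rfl, .inr ⟨by omega, h⟩⟩

theorem extremalGraph_isCycles (ha : a % 2 = 0) (ha2 : 2 ≤ a) (hb : 1 ≤ b) :
    (extremalGraph a b).IsCycles := by
  rintro ⟨x, y⟩ ⟨q, hq⟩
  rw [SimpleGraph.mem_neighborSet, extremalGraph_adj_iff] at hq
  have key : ∃ r t : ℤ × ℤ, r ≠ t ∧ (extremalGraph a b).neighborSet (x, y) = {r, t} := by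
    simp only [Set.ext_iff, SimpleGraph.mem_neighborSet, extremalGraph_adj_iff,
      Set.mem_insert_iff, Set.mem_singleton_iff]
    rcases noneOrTwo_incident ha ha2 hb x y with h | h | h | h | h | h | h <;>
      obtain ⟨h1, h2, h3, h4⟩ := h
    · exact absurd hq (by tauto)
    · exact ⟨(x + 1, y), (x, y + 1), by simp, by tauto⟩
    · exact ⟨(x + 1, y), (x - 1, y), by simp; omega, by tauto⟩
    · exact ⟨(x + 1, y), (x, y - 1), by simp, by tauto⟩
    · exact ⟨(x, y + 1), (x - 1, y), by simp, by tauto⟩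
    · exact ⟨(x, y + 1), (x, y - 1), by simp; omega, by tauto⟩
    · exact ⟨(x - 1, y), (x, y - 1), by simp, by tauto⟩
  obtain ⟨r, t, hrt, h⟩ := key
  rw [h, Set.ncard_pair hrt]

theorem adj_right {x y : ℤ} (h : Hor a b 0 x y) : (extremalGraph a b).Adj (x, y) (x + 1, y) :=
  extremalGraph_adj_iff.2 (.inl ⟨rfl, h⟩)

theorem adj_up {x y : ℤ} (h : Ver a b 0 x y) : (extremalGraph a b).Adj (x, y) (x, y + 1) :=
  extremalGraph_adj_iff.2 (.inr (.inl ⟨rfl, h⟩))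

/-! ### Connectedness of the extremal graph -/

/-- The deviation of the zigzag paths from the antidiagonals. -/
def zigzag (t : ℤ) : ℤ := if t % 4 = 1 then -1 else if t % 4 = 3 then 1 else 0

/-- The vertices of the `i`-th zigzag path of an extremal cycle. -/
def pathVertex (b i t : ℤ) : ℤ × ℤ := ((2 * i + t + zigzag t) / 2, b + (2 * i - t + zigzag t) / 2)

theorem pathVertex_adj {i t : ℤ} (hi : 1 ≤ i) (hi' : i ≤ a) (ht : 0 ≤ t) (ht' : t < 2 * b) :
    (extremalGraph a b).Adj (pathVertex b i t) (pathVertex b i (t + 1)) := by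
  have hc : t % 4 = 0 ∨ t % 4 = 1 ∨ t % 4 = 2 ∨ t % 4 = 3 := by omega
  rw [pathVertex, extremalGraph_adj_iff, pathVertex]
  simp only [Prod.mk.injEq]
  rcases hc with h | h | h | h
  · have h1 : zigzag t = 0 := by unfold zigzag; split_ifs <;> omega
    have h2 : zigzag (t + 1) = -1 := by unfold zigzag; split_ifs <;> omega
    rw [h1, h2]
    exact .inr <| .inr <| .inr ⟨⟨by omega, by omega⟩,
      (ver_of_strip (by omega) (by omega)).2 ⟨by omega, by omega, by omega⟩⟩
  · have h1 : zigzag t = -1 := by unfold zigzag; split_ifs <;> omega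
    have h2 : zigzag (t + 1) = 0 := by unfold zigzag; split_ifs <;> omega
    rw [h1, h2]
    exact .inl ⟨⟨by omega, by omega⟩,
      (hor_of_strip (by omega) (by omega)).2 ⟨by omega, by omega, by omega⟩⟩
  · have h1 : zigzag t = 0 := by unfold zigzag; split_ifs <;> omega
    have h2 : zigzag (t + 1) = 1 := by unfold zigzag; split_ifs <;> omega
    rw [h1, h2]
    exact .inl ⟨⟨by omega, by omega⟩,
      (hor_of_strip (by omega) (by omega)).2 ⟨by omega, by omega, by omega⟩⟩
  · have h1 : zigzag t = 1 := by unfold zigzag; split_ifs <;> omega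
    have h2 : zigzag (t + 1) = 0 := by unfold zigzag; split_ifs <;> omega
    rw [h1, h2]
    exact .inr <| .inr <| .inr ⟨⟨by omega, by omega⟩,
      (ver_of_strip (by omega) (by omega)).2 ⟨by omega, by omega, by omega⟩⟩

theorem pathVertex_reachable {i : ℤ} (hi : 1 ≤ i) (hi' : i ≤ a) :
    ∀ t : ℕ, (t : ℤ) ≤ 2 * b → (extremalGraph a b).Reachable (i, b + i) (pathVertex b i t)
  | 0, _ => by
    have : pathVertex b i (0 : ℕ) = (i, b + i) := by
      simp [pathVertex, zigzag]
    rw [this]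
  | t + 1, ht => by
    push_cast at ht ⊢
    exact (pathVertex_reachable hi hi' t (by omega)).trans
      (pathVertex_adj hi hi' (by omega) (by omega)).reachable

theorem path_end_reachable (hb : 1 ≤ b) {i : ℤ} (hi : 1 ≤ i) (hi' : i ≤ a) :
    (extremalGraph a b).Reachable (i, b + i) (b + i, i) := by
  have := pathVertex_reachable (a := a) (b := b) hi hi' (2 * b).toNat (by omega)
  rw [Int.toNat_of_nonneg (by omega)] at this
  have h : pathVertex b i (2 * b) = (b + i, i) := by
    have : zigzag (2 * b) = 0 := by unfold zigzag; split_ifs <;> omega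
    rw [pathVertex, this, Prod.mk.injEq]; omega
  rwa [h] at this

/-- Consecutive zigzags are joined by a corner of two common edges: at the upper left from odd to
even index, at the lower right from even to odd index. -/
theorem path_start_reachable (ha : a % 2 = 0) (hb : 1 ≤ b) :
    ∀ i : ℕ, (i : ℤ) + 1 ≤ a →
      (extremalGraph a b).Reachable (1, b + 1) ((i : ℤ) + 1, b + ((i : ℤ) + 1))
  | 0, _ => by simp
  | i + 1, hi => by
    push_cast at hi ⊢
    refine (path_start_reachable ha hb i (by omega)).trans ?_
    have hend := path_end_reachable (a := a) hb (i := (i : ℤ) + 1) (by omega) (by omega)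
    have hend' := path_end_reachable (a := a) hb (i := (i : ℤ) + 1 + 1) (by omega) hi
    obtain ⟨j, hj⟩ : ∃ j : ℤ, (i : ℤ) + 1 = j := ⟨_, rfl⟩
    rw [hj] at hend hend' hi ⊢
    rcases Nat.mod_two_eq_zero_or_one i with h | h
    · have h1 := adj_up (a := a) (b := b) (x := j) (y := b + j)
        (.inr (.inl ⟨rfl, by omega, by omega, by omega⟩))
      have h2 := adj_right (a := a) (b := b) (x := j) (y := b + j + 1)
        (.inr (.inl ⟨by omega, by omega, by omega, by omega⟩))
      rw [← add_assoc b j 1]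
      exact h1.reachable.trans h2.reachable
    · have h1 := adj_right (a := a) (b := b) (x := b + j) (y := j)
        (.inr (.inr (.inl ⟨by omega, by omega, by omega, by omega⟩)))
      have h2 := adj_up (a := a) (b := b) (x := b + j + 1) (y := j)
        (.inr (.inr (.inl ⟨by omega, by omega, by omega, by omega⟩)))
      rw [← add_assoc b j 1] at hend' ⊢
      exact hend.trans (h1.reachable.trans (h2.reachable.trans hend'.symm))

theorem start_reachable (ha : a % 2 = 0) (hb : 1 ≤ b) {i : ℤ} (hi : 1 ≤ i) (hi' : i ≤ a) :
    (extremalGraph a b).Reachable (1, b + 1) (i, b + i) := by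
  obtain ⟨k, rfl⟩ : ∃ k : ℕ, i = k + 1 := ⟨(i - 1).toNat, by omega⟩
  exact path_start_reachable ha hb k hi'

theorem strip_reachable (ha : a % 2 = 0) (hb : 1 ≤ b) {x y i : ℤ} (ht : 0 ≤ x - y + b) (ht' : x - y ≤ b)
    (hi : 1 ≤ i) (hi' : i ≤ a) (h : x + y - b = 2 * i + zigzag (x - y + b)) :
    (extremalGraph a b).Reachable (1, b + 1) (x, y) := by
  have h1 := pathVertex_reachable hi hi' (b := b) (x - y + b).toNat (by omega)
  rw [Int.toNat_of_nonneg ht, pathVertex] at h1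
  refine (start_reachable ha hb hi hi').trans ?_
  convert h1 using 2 <;> omega

theorem bottom_reachable (ha2 : 2 ≤ a) (hb : 1 ≤ b) :
    ∀ k : ℕ, (k : ℤ) + 1 ≤ a → (extremalGraph a b).Reachable (1, b + 1) (b + 1 + k, 1)
  | 0, _ => by simpa using path_end_reachable (a := a) hb le_rfl (by omega)
  | k + 1, hk => by
    push_cast at hk ⊢
    have := adj_right (a := a) (b := b) (x := b + 1 + k) (y := 1)
      (.inr (.inr (.inr ⟨rfl, by omega, by omega⟩)))
    rw [← add_assoc]
    exact (bottom_reachable ha2 hb k (by omega)).trans this.reachable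

/-- The bottom row and the right side carry the link that closes the cycle, from the lower end of
path `1` to that of path `a`. -/
theorem side_reachable (ha2 : 2 ≤ a) (hb : 1 ≤ b) :
    ∀ k : ℕ, (k : ℤ) + 1 ≤ a → (extremalGraph a b).Reachable (1, b + 1) (a + b, (k : ℤ) + 1)
  | 0, _ => by
    have := bottom_reachable ha2 hb (a - 1).toNat (by omega)
    rw [Int.toNat_of_nonneg (by omega)] at this
    convert this using 2
    · ring
    · simp
  | k + 1, hk => by
    push_cast at hk ⊢
    have := adj_up (a := a) (b := b) (x := a + b) (y := (k : ℤ) + 1)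
      (.inr (.inr (.inr ⟨rfl, by omega, by omega⟩)))
    exact (side_reachable ha2 hb k (by omega)).trans this.reachable

theorem reachable_of_hor (ha : a % 2 = 0) (ha2 : 2 ≤ a) (hb : 1 ≤ b) {x y : ℤ} (h : Hor a b 0 x y) :
    (extremalGraph a b).Reachable (1, b + 1) (x, y) := by
  rcases h with ⟨⟨h1, h2, h3, h4⟩, h5⟩ | ⟨rfl, h1, h2, h3⟩ | ⟨rfl, h1, h2, h3⟩ | ⟨rfl, h1, h2⟩
  · refine strip_reachable ha hb (i := (x + y - b - zigzag (x - y + b)) / 2) h3 (by omega) ?_ ?_ ?_ <;>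
    · unfold zigzag
      split_ifs <;> omega
  · have h4 := adj_up (a := a) (b := b) (x := x) (y := b + x) (.inr (.inl ⟨rfl, h1, h2, h3⟩))
    rw [add_comm x b]
    exact (start_reachable ha hb h2 (by omega)).trans h4.reachable
  · exact (start_reachable ha hb (by omega) (by omega)).trans
      (path_end_reachable hb (by omega) (by omega))
  · have := bottom_reachable ha2 hb (x - b - 1).toNat (by omega)
    rw [Int.toNat_of_nonneg (by omega)] at this
    convert this using 2
    ring

theorem reachable_of_ver (ha : a % 2 = 0) (ha2 : 2 ≤ a) (hb : 1 ≤ b) {x y : ℤ} (h : Ver a b 0 x y) :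
    (extremalGraph a b).Reachable (1, b + 1) (x, y) := by
  rcases h with ⟨⟨h1, h2, h3, h4⟩, h5⟩ | ⟨rfl, h1, h2, h3⟩ | ⟨rfl, h1, h2, h3⟩ | ⟨rfl, h1, h2⟩
  · refine strip_reachable ha hb (i := (x + y - b - zigzag (x - y + b)) / 2) (by omega) (by omega)
      ?_ ?_ ?_ <;>
    · unfold zigzag
      split_ifs <;> omega
  · exact start_reachable ha hb h2 (by omega)
  · have h4 := adj_right (a := a) (b := b) (x := b + y) (y := y)
      (.inr (.inr (.inl ⟨rfl, h1, h2, h3⟩)))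
    exact (start_reachable ha hb (by omega) (by omega)).trans
      ((path_end_reachable hb (by omega) (by omega)).trans h4.reachable)
  · have := side_reachable ha2 hb (y - 1).toNat (by omega)
    rw [Int.toNat_of_nonneg (by omega)] at this
    convert this using 2
    ring

theorem reachable_of_adj (ha : a % 2 = 0) (ha2 : 2 ≤ a) (hb : 1 ≤ b) {p q : ℤ × ℤ}
    (h : (extremalGraph a b).Adj p q) : (extremalGraph a b).Reachable (1, b + 1) p := by
  obtain ⟨x, y⟩ := p
  have h' := h
  rw [extremalGraph_adj_iff] at h'
  rcases h' with ⟨rfl, h1⟩ | ⟨rfl, h1⟩ | ⟨rfl, h1⟩ | ⟨rfl, h1⟩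
  · exact reachable_of_hor ha ha2 hb h1
  · exact reachable_of_ver ha ha2 hb h1
  · exact (reachable_of_hor ha ha2 hb h1).trans h.symm.reachable
  · exact (reachable_of_ver ha ha2 hb h1).trans h.symm.reachable

theorem gridGraph_adj_of_extremalGraph_adj (hb : 1 ≤ b) {n : ℕ} (hn : (n : ℤ) = a + b)
    {p q : ℤ × ℤ} (h : (extremalGraph a b).Adj p q) : (gridGraph n n).Adj p q := by
  obtain ⟨x, y⟩ := p
  rw [extremalGraph_adj_iff] at h
  rcases h with ⟨rfl, h1⟩ | ⟨rfl, h1⟩ | ⟨rfl, h1⟩ | ⟨rfl, h1⟩ <;>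
  · have := h1.bounds hb
    simp [gridGraph, gridVertices]
    omega

/-- The edges of the extremal graph form a cycle of the grid. -/
theorem exists_isCycleEdgeSet (ha : a % 2 = 0) (ha2 : 2 ≤ a) (hb : 1 ≤ b) {n : ℕ}
    (hn : (n : ℤ) = a + b) : ∃ C : Finset (Sym2 (ℤ × ℤ)), IsCycleEdgeSet (gridGraph n n) C ∧
      ∀ e, e ∈ C ↔ e ∈ (extremalGraph a b).edgeSet := by
  have hle : extremalGraph a b ≤ gridGraph n n :=
    fun _ _ => gridGraph_adj_of_extremalGraph_adj hb hn
  have h0 : (extremalGraph a b).Adj (1, b + 1) (1, b + 1 + 1) :=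
    adj_up (.inr (.inl ⟨rfl, by omega, by omega, by omega⟩))
  obtain ⟨u, c, hc, he⟩ := exists_isCycle_mem_edges (s := (gridVertices n n : Set (ℤ × ℤ)))
    (fun p q h => (hle h).1) (extremalGraph_isCycles ha ha2 hb) h0
    (fun p q h => reachable_of_adj ha ha2 hb h)
  exact ⟨_, ⟨u, c.mapLe hle, hc.mapLe hle, rfl⟩, by simpa using he⟩

/-! ### The second cycle by reflection -/

/-- The reflection of the grid in its antidiagonal. -/
def antidiagReflection (n : ℕ) : gridGraph n n →g gridGraph n n where
  toFun p := (n + 1 - p.2, n + 1 - p.1)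
  map_rel' := by
    rintro ⟨x, y⟩ ⟨x', y'⟩ h
    simp only [gridGraph, gridVertices, Finset.mem_product, Finset.mem_Icc] at h ⊢
    refine ⟨by omega, by omega, ?_⟩
    rw [← h.2.2, add_comm |x - x'|, sub_sub_sub_cancel_left, sub_sub_sub_cancel_left,
      abs_sub_comm y, abs_sub_comm x]

theorem antidiagReflection_apply (n : ℕ) (x y : ℤ) :
    antidiagReflection n (x, y) = ((n : ℤ) + 1 - y, (n : ℤ) + 1 - x) := rfl

theorem antidiagReflection_involutive (n : ℕ) : Function.Involutive (antidiagReflection n) := by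
  rintro ⟨x, y⟩
  simp [antidiagReflection_apply]

theorem IsCycleEdgeSet.image_antidiagReflection {n : ℕ} {C : Finset (Sym2 (ℤ × ℤ))}
    (hC : IsCycleEdgeSet (gridGraph n n) C) :
    IsCycleEdgeSet (gridGraph n n) (C.image (Sym2.map (antidiagReflection n))) := by
  obtain ⟨v, c, hc, rfl⟩ := hC
  refine ⟨_, c.map (antidiagReflection n), hc.map (antidiagReflection_involutive n).injective, ?_⟩
  ext e
  simp [SimpleGraph.Walk.edges_map]

theorem mem_image_antidiagReflection {n : ℕ} {C : Finset (Sym2 (ℤ × ℤ))} {e : Sym2 (ℤ × ℤ)} :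
    e ∈ C.image (Sym2.map (antidiagReflection n)) ↔ Sym2.map (antidiagReflection n) e ∈ C := by
  have h : ∀ e, Sym2.map (antidiagReflection n) (Sym2.map (antidiagReflection n) e) = e := by
    intro e
    rw [Sym2.map_map, (antidiagReflection_involutive n).comp_self, Sym2.map_id, id]
  rw [Finset.mem_image]
  exact ⟨by rintro ⟨e, he, rfl⟩; rwa [h], fun he => ⟨_, he, h e⟩⟩

/-- The reflection fixes `v` and sends `u` to `2 * a - 1 - u`, which flips the parity of `u + v /
2`; evenness of `a` makes it preserve the common edges. -/
theorem ver_reflect {x y : ℤ} (ha : a % 2 = 0) :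
    Ver a b 0 (a + b + 1 - y) (a + b - x) ↔ Hor a b 1 x y := by
  unfold Ver Hor
  have h1 : CommonVer a b (a + b + 1 - y) (a + b - x) ↔ CommonHor a b x y := by
    unfold CommonVer CommonHor; omega
  have h2 : a + b + 1 - y + (a + b - x) - 1 - b = 2 * a - 1 - (x + y - 1 - b) := by ring
  have h3 : a + b + 1 - y - (a + b - x) + b - 1 = x - y + b := by ring
  rw [h1, h2, h3]
  exact or_congr (by unfold InStrip; omega) Iff.rfl

theorem hor_reflect {x y : ℤ} (ha : a % 2 = 0) :
    Hor a b 0 (a + b - y) (a + b + 1 - x) ↔ Ver a b 1 x y := by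
  unfold Ver Hor
  have h1 : CommonHor a b (a + b - y) (a + b + 1 - x) ↔ CommonVer a b x y := by
    unfold CommonVer CommonHor; omega
  have h2 : a + b - y + (a + b + 1 - x) - 1 - b = 2 * a - 1 - (x + y - 1 - b) := by ring
  have h3 : a + b - y - (a + b + 1 - x) + b = x - y + b - 1 := by ring
  rw [h1, h2, h3]
  exact or_congr (by unfold InStrip; omega) Iff.rfl

/-- `C` consists of the edges given by `Hor` and `Ver`. -/
def IsExtremal (a b σ : ℤ) (C : Finset (Sym2 (ℤ × ℤ))) : Prop :=
  ∀ x y : ℤ, (s((x, y), (x + 1, y)) ∈ C ↔ Hor a b σ x y) ∧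
    (s((x, y), (x, y + 1)) ∈ C ↔ Ver a b σ x y)

theorem exists_isExtremal (ha : a % 2 = 0) (ha2 : 2 ≤ a) (hb : 1 ≤ b) {n : ℕ}
    (hn : (n : ℤ) = a + b) : ∃ C₁ C₂ : Finset (Sym2 (ℤ × ℤ)),
      IsCycleEdgeSet (gridGraph n n) C₁ ∧ IsCycleEdgeSet (gridGraph n n) C₂ ∧
      IsExtremal a b 0 C₁ ∧ IsExtremal a b 1 C₂ := by
  obtain ⟨C, hC, h⟩ := exists_isCycleEdgeSet ha ha2 hb hn
  have h0 : IsExtremal a b 0 C := by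
    intro x y
    rw [h, h, SimpleGraph.mem_edgeSet, SimpleGraph.mem_edgeSet, extremalGraph_adj_iff,
      extremalGraph_adj_iff]
    simp only [Prod.mk.injEq]
    constructor
    · refine ⟨fun h => ?_, fun h => .inl ⟨by simp, h⟩⟩
      rcases h with h | h | h | h
      · exact h.2
      all_goals omega
    · refine ⟨fun h => ?_, fun h => .inr (.inl ⟨by simp, h⟩)⟩
      rcases h with h | h | h | h
      on_goal 2 => exact h.2
      all_goals omega
  refine ⟨C, _, hC, hC.image_antidiagReflection, h0, fun x y => ?_⟩
  rw [mem_image_antidiagReflection, mem_image_antidiagReflection, Sym2.map_mk, Sym2.map_mk]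
  simp only [antidiagReflection_apply, hn]
  rw [← ver_reflect ha, ← hor_reflect ha, ← (h0 _ _).1, ← (h0 _ _).2]
  constructor
  · rw [Sym2.eq_swap]
    ring_nf
  · rw [Sym2.eq_swap]
    ring_nf

/-! ### Equality of the signatures -/

/-- The difference of the indicator functions of the extremal cycles. -/
def stripSign (a b u v : ℤ) : ℤ :=
  if 0 ≤ u ∧ u < 2 * a ∧ 0 ≤ v ∧ v < 2 * b then if (u + v / 2) % 2 = 0 then 1 else -1 else 0

/-- The edges of a cell have indices `u, u + 1` and `v - 1, v`. If both values of `u` are in range,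
the sign alternates in `u`. If exactly one is, `v` is even, so `v - 1` and `v` have opposite signs.
The exceptions would be `v = 0` and `v = 2 * b` at a corner of the strip, which the bounds on `x`
and `y` exclude. -/
theorem stripSign_sum {x y : ℤ} (hx : 1 ≤ x) (hx' : x < a + b) (hy : 1 ≤ y) (hy' : y < a + b) :
    stripSign a b (x + y - 1 - b) (x - y + b) + stripSign a b (x + y - b) (x - y + b - 1) +
      stripSign a b (x + y - 1 - b) (x - y + b - 1) + stripSign a b (x + y - b) (x - y + b) = 0 := by
  obtain ⟨u, hu⟩ : ∃ u, x + y - 1 - b = u := ⟨_, rfl⟩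
  obtain ⟨v, hv⟩ : ∃ v, x - y + b = v := ⟨_, rfl⟩
  rw [show x + y - b = u + 1 by omega, hu, hv]
  have h1 : ∀ v, 0 ≤ u → u + 1 < 2 * a → stripSign a b u v + stripSign a b (u + 1) v = 0 := by
    intro v h h'
    unfold stripSign
    split_ifs <;> omega
  have h2 : ∀ u, 1 ≤ v → v < 2 * b → v % 2 = 0 →
      stripSign a b u v + stripSign a b u (v - 1) = 0 := by
    intro u h h' h''
    unfold stripSign
    split_ifs <;> omega
  have h3 : ∀ u, v < 0 ∨ 2 * b < v → stripSign a b u v + stripSign a b u (v - 1) = 0 := by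
    intro u h
    unfold stripSign
    split_ifs <;> omega
  have h4 : ∀ u v, u < 0 ∨ 2 * a ≤ u → stripSign a b u v = 0 := by
    intro u v h
    unfold stripSign
    rw [if_neg (by omega)]
  rcases (by omega : u < -1 ∨ u = -1 ∨ 0 ≤ u ∧ u + 1 < 2 * a ∨ u + 1 = 2 * a ∨ 2 * a ≤ u) with
    h | h | h | h | h
  · simp [h4 u _ (.inl (by omega)), h4 (u + 1) _ (.inl (by omega))]
  · have := h4 u v (.inl (by omega))
    have := h4 u (v - 1) (.inl (by omega))
    rcases (by omega : v < 0 ∨ 2 * b < v ∨ 1 ≤ v ∧ v < 2 * b) with hv' | hv' | hv'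
    · linarith [h3 (u + 1) (.inl hv')]
    · linarith [h3 (u + 1) (.inr hv')]
    · linarith [h2 (u + 1) hv'.1 hv'.2 (by omega)]
  · linarith [h1 v h.1 h.2, h1 (v - 1) h.1 h.2]
  · have := h4 (u + 1) v (.inr (by omega))
    have := h4 (u + 1) (v - 1) (.inr (by omega))
    rcases (by omega : v < 0 ∨ 2 * b < v ∨ 1 ≤ v ∧ v < 2 * b) with hv' | hv' | hv'
    · linarith [h3 u (.inl hv')]
    · linarith [h3 u (.inr hv')]
    · linarith [h2 u hv'.1 hv'.2 (by omega)]
  · simp [h4 u _ (.inr (by omega)), h4 (u + 1) _ (.inr (by omega))]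

theorem commonHor_not_inStrip {x y : ℤ} (h : CommonHor a b x y) :
    ¬InStrip a b (x + y - 1 - b) (x - y + b) := by
  unfold CommonHor at h; unfold InStrip; omega

theorem commonVer_not_inStrip {x y : ℤ} (h : CommonVer a b x y) :
    ¬InStrip a b (x + y - 1 - b) (x - y + b - 1) := by
  unfold CommonVer at h; unfold InStrip; omega

theorem toNat_sub_toNat {u v : ℤ} {p q : Bool} {c : Prop}
    (hp : p = true ↔ InStrip a b u v ∧ (u + v / 2) % 2 = 0 ∨ c)
    (hq : q = true ↔ InStrip a b u v ∧ (u + v / 2) % 2 = 1 ∨ c) (hc : c → ¬InStrip a b u v) :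
    (p.toNat : ℤ) - q.toNat = stripSign a b u v := by
  by_cases h : InStrip a b u v
  · rw [stripSign, if_pos (show 0 ≤ u ∧ u < 2 * a ∧ 0 ≤ v ∧ v < 2 * b from h)]
    rcases Int.emod_two_eq_zero_or_one (u + v / 2) with h1 | h1
    · have : p = true := hp.2 (.inl ⟨h, h1⟩)
      have : q = false := by
        rw [← Bool.not_eq_true, hq]
        rintro (h2 | h2)
        · omega
        · exact hc h2 h
      simp [*]
    · have : q = true := hq.2 (.inl ⟨h, h1⟩)
      have : p = false := by
        rw [← Bool.not_eq_true, hp]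
        rintro (h2 | h2)
        · omega
        · exact hc h2 h
      simp [*]
  · have : p = q := by rw [Bool.eq_iff_iff, hp, hq]; tauto
    rw [stripSign, if_neg (show ¬(0 ≤ u ∧ u < 2 * a ∧ 0 ≤ v ∧ v < 2 * b) from h), this, sub_self]

theorem signature_eq_of_isExtremal {n : ℕ} (hn : (n : ℤ) = a + b) {C₁ C₂ : Finset (Sym2 (ℤ × ℤ))}
    (h₁ : IsExtremal a b 0 C₁) (h₂ : IsExtremal a b 1 C₂) :
    signature n n C₁ = signature n n C₂ := by
  ext ⟨⟨x, y⟩, h⟩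
  have h' := h
  simp only [gridCells, Finset.mem_product, Finset.mem_Ico] at h'
  lift x to ℕ using by omega
  lift y to ℕ using by omega
  rw [signature_apply h, signature_apply h]
  have hh : ∀ x y : ℕ, ((decide (hEdge x y ∈ C₁)).toNat : ℤ) - (decide (hEdge x y ∈ C₂)).toNat =
      stripSign a b (x + y - 1 - b) (x - y + b) := fun x y =>
    toNat_sub_toNat (decide_eq_true_iff.trans (h₁ x y).1) (decide_eq_true_iff.trans (h₂ x y).1)
      commonHor_not_inStrip
  have hv : ∀ x y : ℕ, ((decide (vEdge x y ∈ C₁)).toNat : ℤ) - (decide (vEdge x y ∈ C₂)).toNat =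
      stripSign a b (x + y - 1 - b) (x - y + b - 1) := fun x y =>
    toNat_sub_toNat (decide_eq_true_iff.trans (h₁ x y).2) (decide_eq_true_iff.trans (h₂ x y).2)
      commonVer_not_inStrip
  have e1 := hh x y
  have e2 := hh x (y + 1)
  have e3 := hv x y
  have e4 := hv (x + 1) y
  have e5 := stripSign_sum (a := a) (b := b) (x := x) (y := y) (by omega) (by omega) (by omega)
    (by omega)
  push_cast at e2 e4
  rw [show (x : ℤ) + (y + 1) - 1 - b = x + y - b by ring,
    show (x : ℤ) - (y + 1) + b = x - y + b - 1 by ring] at e2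
  rw [show (x : ℤ) + 1 + y - 1 - b = x + y - b by ring,
    show (x : ℤ) + 1 - y + b - 1 = x - y + b by ring] at e4
  omega

/-! ### The size of the difference -/

/-- The edge with given coordinates in the strip. -/
def stripEdge (b : ℤ) (p : ℤ × ℤ) : Sym2 (ℤ × ℤ) :=
  if (p.1 + p.2) % 2 = 1 then
    s(((p.1 + p.2 + 1) / 2, (p.1 - p.2 + 1) / 2 + b),
      ((p.1 + p.2 + 1) / 2 + 1, (p.1 - p.2 + 1) / 2 + b))
  else
    s(((p.1 + p.2) / 2 + 1, (p.1 - p.2) / 2 + b), ((p.1 + p.2) / 2 + 1, (p.1 - p.2) / 2 + b + 1))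

theorem stripEdge_injective (b : ℤ) : Function.Injective (stripEdge b) := by
  rintro ⟨u, v⟩ ⟨u', v'⟩ h
  unfold stripEdge at h
  split_ifs at h with h1 h2 h2 <;>
  · simp only [Sym2.eq_iff, Prod.mk.injEq] at h h1 h2 ⊢
    omega

theorem mem_symmDiff_of_inStrip {u v : ℤ} {c : Prop} {α : Type*} [DecidableEq α] {e : α}
    {C₁ C₂ : Finset α} (h₁ : e ∈ C₁ ↔ InStrip a b u v ∧ (u + v / 2) % 2 = 0 ∨ c)
    (h₂ : e ∈ C₂ ↔ InStrip a b u v ∧ (u + v / 2) % 2 = 1 ∨ c) (hc : c → ¬InStrip a b u v) :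
    e ∈ symmDiff C₁ C₂ ↔ InStrip a b u v := by
  rw [Finset.mem_symmDiff, h₁, h₂]
  rcases Int.emod_two_eq_zero_or_one (u + v / 2) with h | h <;> simp only [h] <;> tauto

theorem IsExtremal.hor_mem_symmDiff {C₁ C₂ : Finset (Sym2 (ℤ × ℤ))} (h₁ : IsExtremal a b 0 C₁)
    (h₂ : IsExtremal a b 1 C₂) (x y : ℤ) : s((x, y), (x + 1, y)) ∈ symmDiff C₁ C₂ ↔
      InStrip a b (x + y - 1 - b) (x - y + b) :=
  mem_symmDiff_of_inStrip (h₁ x y).1 (h₂ x y).1 commonHor_not_inStrip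

theorem IsExtremal.ver_mem_symmDiff {C₁ C₂ : Finset (Sym2 (ℤ × ℤ))} (h₁ : IsExtremal a b 0 C₁)
    (h₂ : IsExtremal a b 1 C₂) (x y : ℤ) : s((x, y), (x, y + 1)) ∈ symmDiff C₁ C₂ ↔
      InStrip a b (x + y - 1 - b) (x - y + b - 1) :=
  mem_symmDiff_of_inStrip (h₁ x y).2 (h₂ x y).2 commonVer_not_inStrip

theorem card_symmDiff_of_isExtremal {n : ℕ} {C₁ C₂ : Finset (Sym2 (ℤ × ℤ))}
    (hC₁ : IsCycleEdgeSet (gridGraph n n) C₁) (hC₂ : IsCycleEdgeSet (gridGraph n n) C₂)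
    (h₁ : IsExtremal a b 0 C₁) (h₂ : IsExtremal a b 1 C₂) :
    (symmDiff C₁ C₂).card = (2 * a).toNat * (2 * b).toNat := by
  have key : symmDiff C₁ C₂ =
      (Finset.Ico 0 (2 * a) ×ˢ Finset.Ico 0 (2 * b)).image (stripEdge b) := by
    ext e
    simp only [Finset.mem_image, Finset.mem_product, Finset.mem_Ico]
    constructor
    · intro he
      have he' : e ∈ (gridGraph n n).edgeSet := by
        rcases Finset.mem_symmDiff.1 he with h | h
        exacts [subset_edgeSet hC₁ h.1, subset_edgeSet hC₂ h.1]
      rcases edge_cases he' with ⟨x, y, rfl⟩ | ⟨x, y, rfl⟩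
      · obtain ⟨h3, h4, h5, h6⟩ := (h₁.hor_mem_symmDiff h₂ x y).1 he
        refine ⟨(_, _), ⟨⟨h3, h4⟩, ⟨h5, h6⟩⟩, ?_⟩
        rw [stripEdge, if_pos (by simp only; omega), hEdge]
        congr 3 <;> simp only <;> omega
      · obtain ⟨h3, h4, h5, h6⟩ := (h₁.ver_mem_symmDiff h₂ x y).1 he
        refine ⟨(_, _), ⟨⟨h3, h4⟩, ⟨h5, h6⟩⟩, ?_⟩
        rw [stripEdge, if_neg (by simp only; omega), vEdge]
        congr 3 <;> simp only <;> omega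
    · rintro ⟨⟨u, v⟩, h, rfl⟩
      unfold stripEdge
      split_ifs with h3 <;> simp only at h h3 ⊢
      · rw [h₁.hor_mem_symmDiff h₂]
        unfold InStrip; omega
      · rw [h₁.ver_mem_symmDiff h₂]
        unfold InStrip; omega
  rw [key, Finset.card_image_of_injective _ (stripEdge_injective b), Finset.card_product,
    Int.card_Ico, Int.card_Ico, sub_zero, sub_zero]

/-- There are two cycles with the same signature which differ in `4 * (a * b)` edges. -/
theorem exists_card_symmDiff_eq {a b n : ℕ} (hab : a + b = n) (ha : a % 2 = 0) (ha2 : 2 ≤ a)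
    (hb : 1 ≤ b) : ∃ C₁ C₂ : Finset (Sym2 (ℤ × ℤ)),
      IsCycleEdgeSet (gridGraph n n) C₁ ∧ IsCycleEdgeSet (gridGraph n n) C₂ ∧
      signature n n C₁ = signature n n C₂ ∧ 4 * (a * b) = (symmDiff C₁ C₂).card := by
  have hn : (n : ℤ) = a + b := by omega
  obtain ⟨C₁, C₂, hC₁, hC₂, h₁, h₂⟩ :=
    exists_isExtremal (a := a) (b := b) (by omega) (by omega) (by omega) hn
  refine ⟨C₁, C₂, hC₁, hC₂, signature_eq_of_isExtremal hn h₁ h₂, ?_⟩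
  rw [card_symmDiff_of_isExtremal hC₁ hC₂ h₁ h₂, show (2 * (a : ℤ)).toNat = 2 * a by omega,
    show (2 * (b : ℤ)).toNat = 2 * b by omega]
  ring

/-! ### The case `n = 2` and the choice of `a` and `b` -/

theorem exists_isCycleEdgeSet_two : ∃ C, IsCycleEdgeSet (gridGraph 2 2) C := by
  have h1 : (gridGraph 2 2).Adj (1, 1) (2, 1) := by simp [gridGraph, gridVertices]
  have h2 : (gridGraph 2 2).Adj (2, 1) (2, 2) := by simp [gridGraph, gridVertices]
  have h3 : (gridGraph 2 2).Adj (2, 2) (1, 2) := by simp [gridGraph, gridVertices]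
  have h4 : (gridGraph 2 2).Adj (1, 2) (1, 1) := by simp [gridGraph, gridVertices]
  refine ⟨_, _, .cons h1 (.cons h2 (.cons h3 (.cons h4 .nil))), ?_, rfl⟩
  rw [SimpleGraph.Walk.cons_isCycle_iff]
  simp [SimpleGraph.Walk.cons_isPath_iff]

theorem exists_four_mul_eq {n : ℕ} (hn : 3 ≤ n) :
    ∃ a b, a + b = n ∧ a % 2 = 0 ∧ 2 ≤ a ∧ 1 ≤ b ∧ 4 * (a * b) = n ^ 2 - n ^ 2 % 8 := by
  obtain ⟨m, hm⟩ : ∃ m, n = 4 * m ∨ n = 4 * m + 1 ∨ n = 4 * m + 2 ∨ n = 4 * m + 3 :=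
    ⟨n / 4, by omega⟩
  rcases hm with rfl | rfl | rfl | rfl
  · refine ⟨2 * m, 2 * m, by omega, by omega, by omega, by omega, ?_⟩
    ring_nf; omega
  · refine ⟨2 * m, 2 * m + 1, by omega, by omega, by omega, by omega, ?_⟩
    ring_nf; omega
  · refine ⟨2 * m, 2 * m + 2, by omega, by omega, by omega, by omega, ?_⟩
    ring_nf; omega
  · refine ⟨2 * m + 2, 2 * m + 1, by omega, by omega, by omega, by omega, ?_⟩
    ring_nf; omega

end Slitherlink

theorem mainTheorem3 (n : ℕ) (hn : 2 ≤ n) :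
    IsGreatest
      {k : ℕ | ∃ C₁ C₂ : Finset (Sym2 (ℤ × ℤ)),
        Slitherlink.IsCycleEdgeSet (Slitherlink.gridGraph n n) C₁ ∧
        Slitherlink.IsCycleEdgeSet (Slitherlink.gridGraph n n) C₂ ∧
        Slitherlink.signature n n C₁ = Slitherlink.signature n n C₂ ∧
        k = (symmDiff C₁ C₂).card}
      (n ^ 2 - n ^ 2 % 8) := by
  constructor
  · rcases (by omega : n = 2 ∨ 3 ≤ n) with rfl | h
    -- Here the bound is `4 - 4 = 0`, attained by a cycle paired with itself.
    · obtain ⟨C, hC⟩ := Slitherlink.exists_isCycleEdgeSet_two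
      exact ⟨C, C, hC, hC, rfl, by simp⟩
    · obtain ⟨a, b, hab, ha, ha2, hb, h4⟩ := Slitherlink.exists_four_mul_eq h
      rw [← h4]
      exact Slitherlink.exists_card_symmDiff_eq hab ha ha2 hb
  · rintro k ⟨C₁, C₂, hC₁, hC₂, h, rfl⟩
    exact Slitherlink.card_symmDiff_le_of_signature_eq hn hC₁ hC₂ h
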